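/- The model of computation is the real RAM: a random access machine with natural number memory (constants, addition, truncated subtraction) and real number memory (addition, subtraction, multiplication, division, square root, inclusion of the natural numbers, no rounding, no real constants), with indirect addressing and exact comparisons, where every elementary operation takes one unit of time. For points $p_1,\dots,p_n$ in $\mathbb{R}^2$ and radii $r(p_i)>0$, the disk graph $G(\mathcal S,r)$ of $\mathcal S=\{p_1,\dots,p_n\}$ has vertex set $\mathcal S$, and two distinct points $p,q$ are adjacent if and only if $\|p-q\|\le r(p)+r(q)$. Let $\Pi$ be a class of finite simple graphs, closed under isomorphism. $\Pi$-Recognition asks whether a given graph (given by its adjacency matrix) belongs to $\Pi$. $\Pi$-Scaling is the following problem. Given a set $\mathcal S$ of $n$ distinct points in the plane (by their coordinates), real numbers $0<r_{\min}\le r_{\max}$, and $k\in\mathbb N$, do there exist a set $\mathcal T\subseteq\mathcal S$ with $|\mathcal T|\le k$ and radii $r\colon\mathcal S\to\mathbb R_{>0}$ such that $r_{\min}\le r(p)\le r_{\max}$ for all $p\in\mathcal T$, $r(p)=1$ for all $p\in\mathcal S\setminus\mathcal T$, and $G(\mathcal S,r)\in\Pi$? **Theorem.** If $\Pi$-Recognition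 can be solved in polynomial time, then $\Pi$-Scaling can be solved in $2^{O(k^2)}\cdot n^{O(k)}$ time. That is, there are a constant $c$ (depending only on $\Pi$) and a single real RAM program that decides every instance in at most $2^{c\,\bar k^2}\cdot\bar n^{\,c\,\bar k}$ steps, where $\bar k=\max(k,1)$ and $\bar n=\max(n,1)$. Consequently, $\Pi$-Scaling is in XP with respect to $k$: it can be solved in time $f(k)\cdot N^{g(k)}$ for some computable functions $f,g$, where $N$ is the input size. -/

import Mathlib

/-! ## The real RAM

Programs of the real RAM, in structured form.  The memory consists of arrays of natural numbers
(counters, indices, discrete data) and of arrays of real numbers.  The name `a` of an array is fixed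
in the program text, whereas indices into arrays are computed at run time (indirect addressing).
Every elementary operation has cost one.  On natural numbers only addition and truncated subtraction
are available (no unit-cost multiplication or bit manipulation of large integers); on real numbers
`+`, `-`, `*`, `/`, square root, exact comparison and the inclusion of the natural numbers, but no
rounding and no real constants.  As a convention `x / 0 = 0`, and the root of a negative number
is `0`. -/

namespace RealRAM

/-- Memory contents: `nat a i` and `real a i` are the cells with index `i` of the arrays named `a`. -/
structure Store where
  nat : ℕ → ℕ → ℕ
  real : ℕ → ℕ → ℝ

/-- Expressions whose value is a natural number. -/
inductive NExp : Type
  | const (c : ℕ) : NExp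
  | read (a : ℕ) (i : NExp) : NExp
  | add (e₁ e₂ : NExp) : NExp
  | sub (e₁ e₂ : NExp) : NExp

/-- The value of an expression. -/
def NExp.eval (s : Store) : NExp → ℕ
  | const c => c
  | read a i => s.nat a (i.eval s)
  | add e₁ e₂ => e₁.eval s + e₂.eval s
  | sub e₁ e₂ => e₁.eval s - e₂.eval s

/-- The number of elementary operations needed to evaluate an expression. -/
def NExp.cost : NExp → ℕ
  | const _ => 1
  | read _ i => i.cost + 1
  | add e₁ e₂ => e₁.cost + e₂.cost + 1
  | sub e₁ e₂ => e₁.cost + e₂.cost + 1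

/-- Expressions whose value is a real number. -/
inductive RExp : Type
  | ofNat (e : NExp) : RExp
  | read (a : ℕ) (i : NExp) : RExp
  | add (e₁ e₂ : RExp) : RExp
  | sub (e₁ e₂ : RExp) : RExp
  | mul (e₁ e₂ : RExp) : RExp
  | div (e₁ e₂ : RExp) : RExp
  | sqrt (e : RExp) : RExp

/-- The value of an expression. -/
noncomputable def RExp.eval (s : Store) : RExp → ℝ
  | ofNat e => (e.eval s : ℝ)
  | read a i => s.real a (i.eval s)
  | add e₁ e₂ => e₁.eval s + e₂.eval s
  | sub e₁ e₂ => e₁.eval s - e₂.eval s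
  | mul e₁ e₂ => e₁.eval s * e₂.eval s
  | div e₁ e₂ => e₁.eval s / e₂.eval s
  | sqrt e => Real.sqrt (e.eval s)

/-- The number of elementary operations needed to evaluate an expression. -/
def RExp.cost : RExp → ℕ
  | ofNat e => e.cost + 1
  | read _ i => i.cost + 1
  | add e₁ e₂ => e₁.cost + e₂.cost + 1
  | sub e₁ e₂ => e₁.cost + e₂.cost + 1
  | mul e₁ e₂ => e₁.cost + e₂.cost + 1
  | div e₁ e₂ => e₁.cost + e₂.cost + 1
  | sqrt e => e.cost + 1

/-- Conditions on which a program may branch. -/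
inductive Test : Type
  | natLt (e₁ e₂ : NExp) : Test
  | realLt (e₁ e₂ : RExp) : Test
  | not (b : Test) : Test
  | and (b₁ b₂ : Test) : Test

/-- Whether a condition holds. -/
def Test.Holds (s : Store) : Test → Prop
  | natLt e₁ e₂ => e₁.eval s < e₂.eval s
  | realLt e₁ e₂ => e₁.eval s < e₂.eval s
  | not b => ¬ b.Holds s
  | and b₁ b₂ => b₁.Holds s ∧ b₂.Holds s

/-- The number of elementary operations needed to evaluate a condition. -/
def Test.cost : Test → ℕ
  | natLt e₁ e₂ => e₁.cost + e₂.cost + 1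
  | realLt e₁ e₂ => e₁.cost + e₂.cost + 1
  | not b => b.cost + 1
  | and b₁ b₂ => b₁.cost + b₂.cost + 1

/-- Programs: assignments to array cells, sequencing, branching, and `while` loops. -/
inductive Prog : Type
  | skip : Prog
  | setNat (a : ℕ) (i e : NExp) : Prog
  | setReal (a : ℕ) (i : NExp) (e : RExp) : Prog
  | seq (p q : Prog) : Prog
  | ite (b : Test) (p q : Prog) : Prog
  | loop (b : Test) (p : Prog) : Prog

/-- Overwrite cell `i` of the natural number array `a`. -/
def Store.writeNat (s : Store) (a i v : ℕ) : Store :=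
  { s with nat := Function.update s.nat a (Function.update (s.nat a) i v) }

/-- Overwrite cell `i` of the real array `a`. -/
noncomputable def Store.writeReal (s : Store) (a i : ℕ) (v : ℝ) : Store :=
  { s with real := Function.update s.real a (Function.update (s.real a) i v) }

/-- `Exec p s t s'`: started in memory `s`, the program `p` halts after exactly `t` steps, with
memory `s'`.  (This is deterministic: `p` and `s` determine `t` and `s'`, if they exist.) -/
inductive Exec : Prog → Store → ℕ → Store → Prop
  | skip (s : Store) : Exec .skip s 1 s
  | setNat (a : ℕ) (i e : NExp) (s : Store) :
      Exec (.setNat a i e) s (i.cost + e.cost + 1) (s.writeNat a (i.eval s) (e.eval s))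
  | setReal (a : ℕ) (i : NExp) (e : RExp) (s : Store) :
      Exec (.setReal a i e) s (i.cost + e.cost + 1) (s.writeReal a (i.eval s) (e.eval s))
  | seq {p q : Prog} {s s' s'' : Store} {t t' : ℕ} :
      Exec p s t s' → Exec q s' t' s'' → Exec (.seq p q) s (t + t') s''
  | ite_true {b : Test} {p q : Prog} {s s' : Store} {t : ℕ} :
      b.Holds s → Exec p s t s' → Exec (.ite b p q) s (b.cost + t + 1) s'
  | ite_false {b : Test} {p q : Prog} {s s' : Store} {t : ℕ} :
      ¬ b.Holds s → Exec q s t s' → Exec (.ite b p q) s (b.cost + t + 1) s'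
  | loop_done {b : Test} {p : Prog} {s : Store} :
      ¬ b.Holds s → Exec (.loop b p) s (b.cost + 1) s
  | loop_step {b : Test} {p : Prog} {s s' s'' : Store} {t t' : ℕ} :
      b.Holds s → Exec p s t s' → Exec (.loop b p) s' t' s'' →
        Exec (.loop b p) s (b.cost + t + t' + 1) s''

/-- A decision problem on the real RAM: instances, the initial memory that presents an instance to
the machine (all cells not used by the input hold `0`), the number of cells that the input occupies,
and the yes-instances. -/
structure Problem where
  Inst : Type
  encode : Inst → Store
  size : Inst → ℕ
  Yes : Inst → Prop

/-- The program `p` solves the problem `Q` in time `T`: on every instance it halts after at most `T`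
steps, and the first cell of the first natural number array is then nonzero if and only if the
instance is a yes-instance. -/
def Solves (p : Prog) (Q : Problem) (T : Q.Inst → ℕ) : Prop :=
  ∀ x : Q.Inst, ∃ (t : ℕ) (s : Store),
    Exec p (Q.encode x) t s ∧ t ≤ T x ∧ (s.nat 0 0 ≠ 0 ↔ Q.Yes x)

/-- The problem `Q` can be solved in time polynomial in the input size. -/
def Problem.InPolyTime (Q : Problem) : Prop :=
  ∃ (p : Prog) (f : Polynomial ℕ), Solves p Q (fun x => f.eval (Q.size x))

/-- The class XP: the problem `Q` with parameter `κ` can be solved in time `f(κ) * size ^ g(κ)`, for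
some computable functions `f` and `g`. -/
def Problem.InXP (Q : Problem) (κ : Q.Inst → ℕ) : Prop :=
  ∃ (p : Prog) (f g : ℕ → ℕ), Computable f ∧ Computable g ∧
    Solves p Q (fun x => f (κ x) * Q.size x ^ g (κ x))

end RealRAM

/-! ## Graph classes and their recognition -/

/-- A class of finite simple graphs that is closed under isomorphism, given by its members with
vertex set `{0, …, n - 1}`. -/
structure GraphClass where
  Mem : ∀ {n : ℕ}, SimpleGraph (Fin n) → Prop
  mem_of_iso : ∀ {n : ℕ} {G H : SimpleGraph (Fin n)}, Nonempty (G ≃g H) → Mem G → Mem H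

open Classical in
/-- A graph as an input: the number `n` of vertices is in cell `0` of the natural number array `0`,
and the adjacency matrix is in the cells `i * n + j` of the natural number array `1`. -/
noncomputable def graphStore (x : Σ n : ℕ, SimpleGraph (Fin n)) : RealRAM.Store where
  nat := fun a m => match a, m with
    | 0, 0 => x.1
    | 1, m => if ∃ i j : Fin x.1, m = (i : ℕ) * x.1 + (j : ℕ) ∧ x.2.Adj i j then 1 else 0
    | _, _ => 0
  real := fun _ _ => 0

/-- The recognition problem of a graph class: is a given graph a member of the class? -/
noncomputable def GraphClass.recognition (C : GraphClass) : RealRAM.Problem where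
  Inst := Σ n : ℕ, SimpleGraph (Fin n)
  encode := graphStore
  size := fun x => 1 + x.1 ^ 2
  Yes := fun x => C.Mem x.2

/-! ## Disk graphs and the scaling problem -/

/-- The disk graph of the centers `pt` and radii `r`: two distinct vertices are adjacent if and only
if their closed disks intersect. -/
noncomputable def diskGraph {n : ℕ} (pt : Fin n → EuclideanSpace ℝ (Fin 2)) (r : Fin n → ℝ) :
    SimpleGraph (Fin n) where
  Adj i j := i ≠ j ∧ dist (pt i) (pt j) ≤ r i + r j
  symm := ⟨fun i j h => ⟨h.1.symm, by rw [dist_comm, add_comm]; exact h.2⟩⟩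
  loopless := ⟨fun _ h => h.1 rfl⟩

/-- An instance of the scaling problem: a set of `n` (distinct) points in the plane, numbered in
some order, an interval of radii, and a budget. -/
structure ScalingInstance where
  n : ℕ
  pt : Fin n → EuclideanSpace ℝ (Fin 2)
  pt_injective : Function.Injective pt
  rmin : ℝ
  rmax : ℝ
  rmin_pos : 0 < rmin
  rmin_le_rmax : rmin ≤ rmax
  k : ℕ

/-- An instance as an input: `n` and `k` are in the cells `0` and `1` of the natural number array
`0`, the bounds on the radii are in the cells `0` and `1` of the real array `0`, and the `x`- and
`y`-coordinates of the points are in the real arrays `1` and `2`. -/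
noncomputable def scalingStore (I : ScalingInstance) : RealRAM.Store where
  nat := fun a m => match a, m with
    | 0, 0 => I.n
    | 0, 1 => I.k
    | _, _ => 0
  real := fun a m => match a, m with
    | 0, 0 => I.rmin
    | 0, 1 => I.rmax
    | 1, m => if h : m < I.n then I.pt ⟨m, h⟩ 0 else 0
    | 2, m => if h : m < I.n then I.pt ⟨m, h⟩ 1 else 0
    | _, _ => 0

/-- The scaling problem of a graph class: can one choose a set `T` of at most `k` disks and rescale
them to radii between `rmin` and `rmax`, all other radii being `1`, so that the disk graph is in the
class? -/
noncomputable def GraphClass.scaling (C : GraphClass) : RealRAM.Problem where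
  Inst := ScalingInstance
  encode := scalingStore
  size := fun I => 4 + 2 * I.n
  Yes := fun I => ∃ (T : Finset (Fin I.n)) (r : Fin I.n → ℝ),
    (∀ i, 0 < r i) ∧ T.card ≤ I.k ∧ (∀ i ∈ T, I.rmin ≤ r i ∧ r i ≤ I.rmax) ∧
      (∀ i ∉ T, r i = 1) ∧ C.Mem (diskGraph I.pt r)

/-! Suppose that a solution exists. Its disk graph imposes `r i + r j ≥ d i j` on edges and `r i + r
j ≤ d i j - δ` on non-edges, for any small enough `δ > 0`. Splitting each radius into an upper
potential `x i = r i` and a lower potential `y i = -r i` turns these sums into difference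
constraints: `x i ≤ y j + d i j - δ` on non-edges, `y i ≤ x j - d i j` on edges, and `x i ≤ rmax`,
`y i ≤ -rmin` for rescaled disks. In a solution of maximal total value, no set of free variables can
be raised simultaneously (`exists_maximal_potential`), so the tight constraints contain a forest
rooted at bounds and at unscaled disks (`exists_rank_of_tight`). The maximal solution need not
satisfy `y = -x`, but averaging shows that the radii `(x i - y i) / 2` respect the same bounds and
give the same graph (`exists_tight_potentials`).

A solution can therefore be replaced by one encoded in `3k` digits below `n + 2`: the rescaled
vertices and, for both potentials of each, a partner in a tight constraint, the vertex itself
standing for a tight bound. Neither the graph nor the order of evaluation has to be guessed: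
applying all the equations for `2k` rounds settles every potential (`Potentials.iterate_sweep_eq`).
Digits that do not come from a solution are harmless, since the bounds and the membership in the
class are tested.

The number `δ` is never chosen by the machine. Potentials are pairs `a + b * δ`, compared
lexicographically, which is correct for all small positive `δ`. As there are finitely many
candidates, one `δ` serves all of them (`ScalingInstance.yes_iff`).

The program counts through the digit sequences and calls the recognition program as a subroutine.
That program expects zeros outside its input, so each call is relocated to a fresh block above all
cells written before (`Exec.reloc`). The running time is `(n + 2) ^ (3k)` times a polynomial in `n`
and `k`, which is even `2 ^ O(k) * n ^ O(k)`. -/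

namespace RealRAM

/-! ### Effect of writing to memory -/

@[simp] lemma Store.nat_writeNat_same (s : Store) (a i v : ℕ) :
    (s.writeNat a i v).nat a = Function.update (s.nat a) i v := by
  simp [Store.writeNat]

@[simp] lemma Store.nat_writeNat_ne (s : Store) {a b : ℕ} (i v : ℕ) (h : b ≠ a) :
    (s.writeNat a i v).nat b = s.nat b := by
  simp [Store.writeNat, h]

@[simp] lemma Store.real_writeNat (s : Store) (a i v : ℕ) : (s.writeNat a i v).real = s.real := rfl

@[simp] lemma Store.real_writeReal_same (s : Store) (a i : ℕ) (v : ℝ) :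
    (s.writeReal a i v).real a = Function.update (s.real a) i v := by
  simp [Store.writeReal]

@[simp] lemma Store.real_writeReal_ne (s : Store) {a b : ℕ} (i : ℕ) (v : ℝ) (h : b ≠ a) :
    (s.writeReal a i v).real b = s.real b := by
  simp [Store.writeReal, h]

@[simp] lemma Store.nat_writeReal (s : Store) (a i : ℕ) (v : ℝ) :
    (s.writeReal a i v).nat = s.nat := rfl

/-! ### Total correctness with a time bound -/

/-- Started in `s`, the program `p` halts after at most `T` steps in a memory satisfying `Q`. -/
def Runs (p : Prog) (s : Store) (T : ℕ) (Q : Store → Prop) : Prop :=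
  ∃ t s', Exec p s t s' ∧ t ≤ T ∧ Q s'

lemma Runs.mono {p : Prog} {s : Store} {T T' : ℕ} {Q Q' : Store → Prop} (h : Runs p s T Q)
    (hT : T ≤ T') (hQ : ∀ s', Q s' → Q' s') : Runs p s T' Q' := by
  obtain ⟨t, s', he, ht, hq⟩ := h
  exact ⟨t, s', he, ht.trans hT, hQ _ hq⟩

lemma runs_skip {s : Store} {T : ℕ} {Q : Store → Prop} (hT : 1 ≤ T) (h : Q s) :
    Runs .skip s T Q := ⟨_, _, .skip s, hT, h⟩

lemma runs_setNat {a : ℕ} {i e : NExp} {s : Store} {T : ℕ} {Q : Store → Prop}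
    (hT : i.cost + e.cost + 1 ≤ T) (h : Q (s.writeNat a (i.eval s) (e.eval s))) :
    Runs (.setNat a i e) s T Q := ⟨_, _, .setNat a i e s, hT, h⟩

lemma runs_setReal {a : ℕ} {i : NExp} {e : RExp} {s : Store} {T : ℕ} {Q : Store → Prop}
    (hT : i.cost + e.cost + 1 ≤ T) (h : Q (s.writeReal a (i.eval s) (e.eval s))) :
    Runs (.setReal a i e) s T Q := ⟨_, _, .setReal a i e s, hT, h⟩

lemma Runs.seq {p q : Prog} {s : Store} {T₁ T₂ : ℕ} {Q R : Store → Prop}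
    (h₁ : Runs p s T₁ R) (h₂ : ∀ s', R s' → Runs q s' T₂ Q) : Runs (.seq p q) s (T₁ + T₂) Q := by
  obtain ⟨t, s', he, ht, hr⟩ := h₁
  obtain ⟨t', s'', he', ht', hq⟩ := h₂ s' hr
  exact ⟨_, _, .seq he he', by omega, hq⟩

lemma runs_ite {b : Test} {p q : Prog} {s : Store} {T : ℕ} {Q : Store → Prop}
    (h₁ : b.Holds s → Runs p s T Q) (h₂ : ¬ b.Holds s → Runs q s T Q) :
    Runs (.ite b p q) s (b.cost + T + 1) Q := by
  by_cases hb : b.Holds s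
  · obtain ⟨t, s', he, ht, hq⟩ := h₁ hb
    exact ⟨_, _, .ite_true hb he, by omega, hq⟩
  · obtain ⟨t, s', he, ht, hq⟩ := h₂ hb
    exact ⟨_, _, .ite_false hb he, by omega, hq⟩

/-- The invariant is indexed by the number of completed iterations, which is known to be exactly
`N`; termination and the time bound follow together. -/
lemma runs_loop {b : Test} {p : Prog} {B : ℕ} (N : ℕ) (Inv : ℕ → Store → Prop)
    (hstep : ∀ v < N, ∀ s, Inv v s → b.Holds s ∧ Runs p s B (Inv (v + 1)))
    (hend : ∀ s, Inv N s → ¬ b.Holds s) {s : Store} (h0 : Inv 0 s) :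
    Runs (.loop b p) s (N * (b.cost + B + 1) + (b.cost + 1)) (Inv N) := by
  -- Induction on the number `m` of iterations that remain.
  suffices H : ∀ m ≤ N, ∀ s, Inv (N - m) s →
      Runs (.loop b p) s (m * (b.cost + B + 1) + (b.cost + 1)) (Inv N) from
    H N le_rfl s (by simpa using h0)
  intro m
  induction m with
  | zero => exact fun _ s hs => ⟨_, _, .loop_done (hend s (by simpa using hs)), by simp, by simpa using hs⟩
  | succ m ih =>
    intro hm s hs
    obtain ⟨hb, t, s', he, ht, hq⟩ := hstep _ (by omega) s hs
    obtain ⟨t', s'', he', ht', hq'⟩ := ih (by omega) s' (by rwa [show N - m = N - (m + 1) + 1 by omega])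
    exact ⟨_, _, .loop_step hb he he', by rw [Nat.add_mul]; omega, hq'⟩

/-- The scalar variable stored in cell `0` of array `a`. -/
abbrev NExp.var (a : ℕ) : NExp := .read a (.const 0)

/-- `forLoop a N p` runs `p` with `a = 0, 1, …, N - 1`. -/
def forLoop (a : ℕ) (N : NExp) (p : Prog) : Prog :=
  .seq (.setNat a (.const 0) (.const 0))
    (.loop (.natLt (.var a) N) (.seq p (.setNat a (.const 0) (.add (.var a) (.const 1)))))

/-- Hypothesis `hw` makes the invariant insensitive to the counter cell, so that resetting and
incrementing it need no separate argument; the value of the counter is tracked alongside. The bound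
is re-evaluated at every test, hence `hN` for all `m ≤ n`. -/
lemma runs_forLoop {a : ℕ} {N : NExp} {p : Prog} {B : ℕ} (n : ℕ) (Inv : ℕ → Store → Prop)
    (hN : ∀ m ≤ n, ∀ s, Inv m s → N.eval s = n)
    (hw : ∀ m ≤ n, ∀ s v, Inv m s → Inv m (s.writeNat a 0 v))
    (hstep : ∀ m < n, ∀ s, Inv m s → s.nat a 0 = m →
      Runs p s B (fun s' => s'.nat a 0 = m ∧ Inv (m + 1) s'))
    {s : Store} (h0 : Inv 0 s) :
    Runs (forLoop a N p) s (n * (N.cost + B + 10) + N.cost + 10) (Inv n) := by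
  refine Runs.mono (T := 3 + (n * ((N.cost + 3) + (B + 6) + 1) + ((N.cost + 3) + 1)))
    (Q := fun s => Inv n s ∧ s.nat a 0 = n) ?_ ?_ (fun _ h => h.1)
  · refine Runs.seq (R := fun s => Inv 0 s ∧ s.nat a 0 = 0) (runs_setNat (by simp [NExp.cost]) ?_) ?_
    · exact ⟨hw 0 (Nat.zero_le _) _ _ h0, by simp [NExp.eval]⟩
    · intro s hs
      have key := runs_loop (b := .natLt (.var a) N)
        (p := .seq p (.setNat a (.const 0) (.add (.var a) (.const 1)))) (B := B + 6) n
        (fun m s => Inv m s ∧ s.nat a 0 = m) ?_ ?_ hs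
      · refine key.mono ?_ fun _ h => h
        simp only [Test.cost, NExp.cost]
        apply le_of_eq; ring
      · rintro v hv s ⟨h1, h2⟩
        refine ⟨by simpa [Test.Holds, NExp.eval, hN v hv.le s h1, h2] using hv, ?_⟩
        refine Runs.seq (hstep v hv s h1 h2) ?_
        rintro s' ⟨h3, h4⟩
        refine runs_setNat (by simp [NExp.cost]) ⟨hw _ (by omega) _ _ h4, by simp [NExp.eval, h3]⟩
      · rintro s ⟨h1, h2⟩
        simp [Test.Holds, NExp.eval, hN n le_rfl s h1, h2]
  · have : N.cost + 3 + (B + 6) + 1 = N.cost + B + 10 := by omega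
    rw [this]; omega

/-! ### Arrays that a program does not modify -/

/-- The program never writes to the natural number array `a`. -/
def Prog.KeepsNat (a : ℕ) : Prog → Prop
  | .skip => True
  | .setNat b _ _ => a ≠ b
  | .setReal _ _ _ => True
  | .seq p q => p.KeepsNat a ∧ q.KeepsNat a
  | .ite _ p q => p.KeepsNat a ∧ q.KeepsNat a
  | .loop _ p => p.KeepsNat a

/-- The program never writes to the real array `a`. -/
def Prog.KeepsReal (a : ℕ) : Prog → Prop
  | .skip => True
  | .setNat _ _ _ => True
  | .setReal b _ _ => a ≠ b
  | .seq p q => p.KeepsReal a ∧ q.KeepsReal a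
  | .ite _ p q => p.KeepsReal a ∧ q.KeepsReal a
  | .loop _ p => p.KeepsReal a

lemma Exec.nat_eq {p : Prog} {s s' : Store} {t a : ℕ} (h : Exec p s t s') (hp : p.KeepsNat a) :
    s'.nat a = s.nat a := by
  induction h with
  | skip => rfl
  | setNat b i e s => exact Store.nat_writeNat_ne _ _ _ hp
  | setReal => rfl
  | seq _ _ ih₁ ih₂ => rw [ih₂ hp.2, ih₁ hp.1]
  | ite_true _ _ ih => exact ih hp.1
  | ite_false _ _ ih => exact ih hp.2
  | loop_done => rfl
  | loop_step _ _ _ ih₁ ih₂ => rw [ih₂ hp, ih₁ hp]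

lemma Exec.real_eq {p : Prog} {s s' : Store} {t a : ℕ} (h : Exec p s t s') (hp : p.KeepsReal a) :
    s'.real a = s.real a := by
  induction h with
  | skip => rfl
  | setNat => rfl
  | setReal b i e s => exact Store.real_writeReal_ne _ _ _ hp
  | seq _ _ ih₁ ih₂ => rw [ih₂ hp.2, ih₁ hp.1]
  | ite_true _ _ ih => exact ih hp.1
  | ite_false _ _ ih => exact ih hp.2
  | loop_done => rfl
  | loop_step _ _ _ ih₁ ih₂ => rw [ih₂ hp, ih₁ hp]

/-- Arrays that the program does not write to keep their contents. -/
lemma Runs.frame {p : Prog} {s : Store} {T : ℕ} {Q : Store → Prop} (h : Runs p s T Q) :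
    Runs p s T (fun s' => Q s' ∧ (∀ a, p.KeepsNat a → s'.nat a = s.nat a) ∧
      ∀ a, p.KeepsReal a → s'.real a = s.real a) := by
  obtain ⟨t, s', he, ht, hq⟩ := h
  exact ⟨t, s', he, ht, hq, fun _ => he.nat_eq, fun _ => he.real_eq⟩

/-! ### Relocating a program

All arrays of a program are renamed by adding `12`, and all indices are shifted by the number in
cell `0` of array `10`.  Cell `0` of array `11` is kept above all indices written so far. -/

def NExp.reloc : NExp → NExp
  | const c => const c
  | read a i => read (a + 12) (add (var 10) i.reloc)
  | add e₁ e₂ => add e₁.reloc e₂.reloc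
  | sub e₁ e₂ => sub e₁.reloc e₂.reloc

def RExp.reloc : RExp → RExp
  | ofNat e => ofNat e.reloc
  | read a i => read (a + 12) (.add (.var 10) i.reloc)
  | add e₁ e₂ => add e₁.reloc e₂.reloc
  | sub e₁ e₂ => sub e₁.reloc e₂.reloc
  | mul e₁ e₂ => mul e₁.reloc e₂.reloc
  | div e₁ e₂ => div e₁.reloc e₂.reloc
  | sqrt e => sqrt e.reloc

def Test.reloc : Test → Test
  | natLt e₁ e₂ => natLt e₁.reloc e₂.reloc
  | realLt e₁ e₂ => realLt e₁.reloc e₂.reloc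
  | not b => not b.reloc
  | and b₁ b₂ => and b₁.reloc b₂.reloc

/-- Raise the bound on the indices written so far. -/
def reserve (i : NExp) : Prog :=
  .setNat 11 (.const 0) (.add (.var 11) (.add i (.const 1)))

/-- The reservation precedes the write because the write may change cells on which the index
expression depends. Relocated expressions never read array `11`, so the reservation does not disturb
the index. -/
def Prog.reloc : Prog → Prog
  | skip => skip
  | setNat a i e => seq (reserve i.reloc) (setNat (a + 12) (.add (.var 10) i.reloc) e.reloc)
  | setReal a i e => seq (reserve i.reloc) (setReal (a + 12) (.add (.var 10) i.reloc) e.reloc)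
  | seq p q => seq p.reloc q.reloc
  | ite b p q => ite b.reloc p.reloc q.reloc
  | loop b p => loop b.reloc p.reloc

/-- All relocated cells with index at least `m` hold `0`. -/
def Store.ZeroFrom (u : Store) (m : ℕ) : Prop :=
  ∀ a i, m ≤ i → u.nat (a + 12) i = 0 ∧ u.real (a + 12) i = 0

/-- The memory `u` contains a relocated copy of the memory `s`. -/
structure Relocated (s u : Store) : Prop where
  nat : ∀ a i, u.nat (a + 12) (u.nat 10 0 + i) = s.nat a i
  real : ∀ a i, u.real (a + 12) (u.nat 10 0 + i) = s.real a i
  le : u.nat 10 0 ≤ u.nat 11 0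
  zero : u.ZeroFrom (u.nat 11 0)

namespace Relocated

variable {s u : Store}

lemma nexp (h : Relocated s u) (e : NExp) : e.reloc.eval u = e.eval s := by
  induction e with
  | const c => rfl
  | read a i ih => simp [NExp.reloc, NExp.eval, ih, h.nat]
  | add _ _ ih₁ ih₂ => simp [NExp.reloc, NExp.eval, ih₁, ih₂]
  | sub _ _ ih₁ ih₂ => simp [NExp.reloc, NExp.eval, ih₁, ih₂]

lemma rexp (h : Relocated s u) (e : RExp) : e.reloc.eval u = e.eval s := by
  induction e with
  | ofNat e => simp [RExp.reloc, RExp.eval, h.nexp]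
  | read a i => simp [RExp.reloc, RExp.eval, NExp.eval, h.nexp, h.real]
  | add _ _ ih₁ ih₂ => simp [RExp.reloc, RExp.eval, ih₁, ih₂]
  | sub _ _ ih₁ ih₂ => simp [RExp.reloc, RExp.eval, ih₁, ih₂]
  | mul _ _ ih₁ ih₂ => simp [RExp.reloc, RExp.eval, ih₁, ih₂]
  | div _ _ ih₁ ih₂ => simp [RExp.reloc, RExp.eval, ih₁, ih₂]
  | sqrt _ ih => simp [RExp.reloc, RExp.eval, ih]

lemma test (h : Relocated s u) (b : Test) : b.reloc.Holds u ↔ b.Holds s := by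
  induction b with
  | natLt => simp [Test.reloc, Test.Holds, h.nexp]
  | realLt => simp [Test.reloc, Test.Holds, h.rexp]
  | not _ ih => simp [Test.reloc, Test.Holds, ih]
  | and _ _ ih₁ ih₂ => simp [Test.reloc, Test.Holds, ih₁, ih₂]

/-- Adding `i + 1` to the old bound, instead of taking a maximum, avoids a branch; since the base is
at most the old bound, the new bound exceeds base plus `i`. -/
lemma reserve (h : Relocated s u) (i : ℕ) :
    Relocated s (u.writeNat 11 0 (u.nat 11 0 + (i + 1))) where
  nat a j := by simpa using h.nat a j
  real a j := by simpa using h.real a j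
  le := by simpa using h.le.trans (by omega)
  zero a j hj := by
    simp at hj
    simpa using h.zero a j (by omega)

lemma writeNat (h : Relocated s u) {a i v : ℕ} (hi : u.nat 10 0 + i < u.nat 11 0) :
    Relocated (s.writeNat a i v) (u.writeNat (a + 12) (u.nat 10 0 + i) v) where
  nat b j := by
    by_cases hb : b = a
    · subst hb
      by_cases hj : j = i
      · simp [hj]
      · simp [hj, h.nat]
    · simp [hb, h.nat]
  real b j := by simpa using h.real b j
  le := by simpa using h.le
  zero b j hj := by
    have hj : u.nat 11 0 ≤ j := by simpa using hj
    refine ⟨?_, by simpa using (h.zero b j hj).2⟩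
    by_cases hb : b = a
    · subst hb
      simp [(h.zero b j hj).1, show j ≠ u.nat 10 0 + i by omega]
    · simp [hb, (h.zero b j hj).1]

lemma writeReal (h : Relocated s u) {a i : ℕ} {v : ℝ} (hi : u.nat 10 0 + i < u.nat 11 0) :
    Relocated (s.writeReal a i v) (u.writeReal (a + 12) (u.nat 10 0 + i) v) where
  real b j := by
    by_cases hb : b = a
    · subst hb
      by_cases hj : j = i
      · simp [hj]
      · simp [hj, h.real]
    · simp [hb, h.real]
  nat b j := by simpa using h.nat b j
  le := by simpa using h.le
  zero b j hj := by
    have hj : u.nat 11 0 ≤ j := by simpa using hj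
    refine ⟨by simpa using (h.zero b j hj).1, ?_⟩
    by_cases hb : b = a
    · subst hb
      simp [(h.zero b j hj).2, show j ≠ u.nat 10 0 + i by omega]
    · simp [hb, (h.zero b j hj).2]

end Relocated

/-! ### Simulation by the relocated program with constant overhead -/

lemma NExp.cost_pos (e : NExp) : 1 ≤ e.cost := by cases e <;> simp [NExp.cost]

lemma RExp.cost_pos (e : RExp) : 1 ≤ e.cost := by cases e <;> simp [RExp.cost]

lemma NExp.cost_reloc (e : NExp) : e.reloc.cost ≤ 4 * e.cost := by
  induction e <;> simp only [NExp.reloc, NExp.cost] <;> omega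

lemma RExp.cost_reloc (e : RExp) : e.reloc.cost ≤ 4 * e.cost := by
  induction e with
  | ofNat e => have := e.cost_reloc; simp only [RExp.reloc, RExp.cost]; omega
  | read a i => have := i.cost_reloc; simp only [RExp.reloc, RExp.cost, NExp.cost]; omega
  | _ => simp only [RExp.reloc, RExp.cost]; omega

lemma Test.cost_reloc (b : Test) : b.reloc.cost ≤ 4 * b.cost := by
  induction b with
  | natLt e₁ e₂ =>
    have := e₁.cost_reloc; have := e₂.cost_reloc; simp only [Test.reloc, Test.cost]; omega
  | realLt e₁ e₂ =>
    have := e₁.cost_reloc; have := e₂.cost_reloc; simp only [Test.reloc, Test.cost]; omega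
  | _ => simp only [Test.reloc, Test.cost]; omega

/-- Expressions become at most four times as expensive, and an assignment evaluates its index twice,
once for the reservation; the factor `12` covers this and the constant overhead. -/
theorem Exec.reloc {p : Prog} {s s' : Store} {t : ℕ} (h : Exec p s t s') :
    ∀ {u : Store}, Relocated s u → Runs p.reloc u (12 * t) (Relocated s') := by
  induction h with
  | skip s => exact fun hu => runs_skip (by norm_num) hu
  | setNat a i e s =>
    intro u hu
    have hc₁ := i.cost_reloc
    have hc₂ := e.cost_reloc
    refine Runs.mono (T := (i.reloc.cost + 7) + (i.reloc.cost + e.reloc.cost + 4)) ?_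
      (by have := i.cost_pos; have := e.cost_pos; omega) fun _ h => h
    refine Runs.seq (R := fun u' => Relocated s u' ∧ u'.nat 10 0 + i.eval s < u'.nat 11 0)
      (runs_setNat (by simp only [NExp.cost]; omega) ?_) ?_
    · simp only [NExp.eval, hu.nexp]
      refine ⟨hu.reserve _, ?_⟩
      have := hu.le
      simp; omega
    · rintro u' ⟨hu', hlt⟩
      refine runs_setNat (by simp only [NExp.cost]; omega) ?_
      simp only [NExp.eval, hu'.nexp]
      exact hu'.writeNat hlt
  | setReal a i e s =>
    intro u hu
    have hc₁ := i.cost_reloc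
    have hc₂ := e.cost_reloc
    refine Runs.mono (T := (i.reloc.cost + 7) + (i.reloc.cost + e.reloc.cost + 4)) ?_
      (by have := i.cost_pos; have := e.cost_pos; omega) fun _ h => h
    refine Runs.seq (R := fun u' => Relocated s u' ∧ u'.nat 10 0 + i.eval s < u'.nat 11 0)
      (runs_setNat (by simp only [NExp.cost]; omega) ?_) ?_
    · simp only [NExp.eval, hu.nexp]
      refine ⟨hu.reserve _, ?_⟩
      have := hu.le
      simp; omega
    · rintro u' ⟨hu', hlt⟩
      refine runs_setReal (by simp only [NExp.cost]; omega) ?_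
      simp only [NExp.eval, hu'.nexp, hu'.rexp]
      exact hu'.writeReal hlt
  | seq _ _ ih₁ ih₂ =>
    intro u hu
    exact (Runs.seq (ih₁ hu) fun u' hu' => ih₂ hu').mono (by omega) fun _ h => h
  | @ite_true b p q s s' t hb _ ih =>
    intro u hu
    obtain ⟨t', u', he, ht, hr⟩ := ih hu
    have := b.cost_reloc
    exact ⟨_, _, .ite_true ((hu.test b).2 hb) he, by omega, hr⟩
  | @ite_false b p q s s' t hb _ ih =>
    intro u hu
    obtain ⟨t', u', he, ht, hr⟩ := ih hu
    have := b.cost_reloc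
    exact ⟨_, _, .ite_false (fun h => hb ((hu.test b).1 h)) he, by omega, hr⟩
  | @loop_done b p s hb =>
    intro u hu
    have := b.cost_reloc
    exact ⟨_, _, .loop_done (fun h => hb ((hu.test b).1 h)), by omega, hu⟩
  | @loop_step b p s s' s'' t t' hb _ _ ih₁ ih₂ =>
    intro u hu
    obtain ⟨t₁, u₁, he₁, ht₁, hr₁⟩ := ih₁ hu
    obtain ⟨t₂, u₂, he₂, ht₂, hr₂⟩ := ih₂ hr₁
    have := b.cost_reloc
    exact ⟨_, _, .loop_step ((hu.test b).2 hb) he₁ he₂, by omega, hr₂⟩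

/-- The subroutine cannot damage the instance, the digits, the flags or the base address in array
`10`. -/
lemma Prog.keepsNat_reloc (p : Prog) {a : ℕ} (h : a < 11) : p.reloc.KeepsNat a := by
  induction p <;> simp_all [Prog.reloc, reserve, Prog.KeepsNat] <;> omega

lemma Prog.keepsReal_reloc (p : Prog) {a : ℕ} (h : a < 11) : p.reloc.KeepsReal a := by
  induction p <;> simp_all [Prog.reloc, reserve, Prog.KeepsReal]
  omega

end RealRAM

open Filter Topology

/-! ### Maximal potentials and their tight constraints -/

section Potentials

variable {V : Type*} {S : Finset V} {c : V → ℝ} {E : V → V → Prop} {w : V → V → ℝ}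

/-- A feasible system of difference constraints, in which the values outside `S` are fixed and those
in `S` are bounded, has a solution for which every nonempty part of `S` contains a variable with a
tight bound or a tight constraint leading out of that part. -/
lemma exists_maximal_potential [Fintype V] {x₀ : V → ℝ} (hc : ∀ v ∈ S, x₀ v ≤ c v)
    (hE : ∀ v u, E v u → x₀ v ≤ x₀ u + w v u) :
    ∃ x : V → ℝ, x₀ ≤ x ∧ (∀ v ∉ S, x v = x₀ v) ∧ (∀ v ∈ S, x v ≤ c v) ∧
      (∀ v u, E v u → x v ≤ x u + w v u) ∧
      ∀ U ⊆ S, U.Nonempty → ∃ v ∈ U, x v = c v ∨ ∃ u ∉ U, E v u ∧ x v = x u + w v u := by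
  classical
  set K : Set (V → ℝ) := {x | x₀ ≤ x ∧ (∀ v ∉ S, x v = x₀ v) ∧ (∀ v ∈ S, x v ≤ c v) ∧
    ∀ v u, E v u → x v ≤ x u + w v u} with hK
  have hclosed : IsClosed K := by
    simp only [hK, Set.ofPred_and, Set.ofPred_forall]
    refine isClosed_Ici.inter (IsClosed.inter ?_ (IsClosed.inter ?_ ?_))
    · exact isClosed_iInter fun v => isClosed_iInter fun _ =>
        isClosed_eq (continuous_apply v) continuous_const
    · exact isClosed_iInter fun v => isClosed_iInter fun _ =>
        isClosed_le (continuous_apply v) continuous_const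
    · exact isClosed_iInter fun v => isClosed_iInter fun u => isClosed_iInter fun _ =>
        isClosed_le (continuous_apply v) ((continuous_apply u).add continuous_const)
  have hsub : K ⊆ Set.Icc x₀ (fun v => if v ∈ S then c v else x₀ v) := by
    rintro x ⟨h1, h2, h3, -⟩
    refine ⟨h1, fun v => ?_⟩
    by_cases hv : v ∈ S
    · simpa [hv] using h3 v hv
    · simp [hv, h2 v hv]
  have hcomp : IsCompact K := isCompact_Icc.of_isClosed_subset hclosed hsub
  obtain ⟨x, ⟨h1, h2, h3, h4⟩, hmax⟩ := hcomp.exists_isMaxOn (f := fun x => ∑ v, x v)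
    ⟨x₀, le_rfl, fun _ _ => rfl, hc, hE⟩ (by fun_prop)
  refine ⟨x, h1, h2, h3, h4, fun U hU hne => ?_⟩
  by_contra! hcon
  -- If nothing is tight on `U` or out of `U`, all of `U` can be raised by a small `η`: constraints
  -- inside `U` shift on both sides, and those leading into `U` only relax. This contradicts the
  -- maximal sum.
  have hev : ∀ᶠ η : ℝ in 𝓝[>] 0, ∀ v ∈ U, x v + η ≤ c v ∧
      ∀ u ∉ U, E v u → x v + η ≤ x u + w v u := by
    have hsmall : ∀ a b : ℝ, a < b → ∀ᶠ η : ℝ in 𝓝[>] 0, a + η ≤ b := fun a b hab => by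
      filter_upwards [Ioo_mem_nhdsGT (sub_pos.2 hab)] with η hη
      linarith [hη.2]
    simp only [eventually_all, eventually_and]
    refine fun v hv => ⟨hsmall _ _ (lt_of_le_of_ne (h3 v (hU hv)) (hcon v hv).1), fun u hu he => ?_⟩
    exact hsmall _ _ (lt_of_le_of_ne (h4 v u he) ((hcon v hv).2 u hu he))
  obtain ⟨η, hη, hpos⟩ := (hev.and self_mem_nhdsWithin).exists
  have hpos : 0 < η := hpos
  have hy : (fun v => x v + if v ∈ U then η else 0) ∈ K := by
    refine ⟨fun v => (h1 v).trans ?_, fun v hv => ?_, fun v hv => ?_, fun v u he => ?_⟩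
    · dsimp only; split_ifs <;> linarith
    · simp [h2 v hv, show v ∉ U from fun h => hv (hU h)]
    · by_cases hvU : v ∈ U
      · simpa [hvU] using (hη v hvU).1
      · simpa [hvU] using h3 v hv
    · by_cases hvU : v ∈ U <;> by_cases huU : u ∈ U
      · simp only [hvU, huU, if_true]; linarith [h4 v u he]
      · simpa [hvU, huU] using (hη v hvU).2 u huU he
      · simp only [hvU, huU, if_true, if_false]; linarith [h4 v u he]
      · simpa [hvU, huU] using h4 v u he
  have hle := hmax hy
  simp only [Set.mem_ofPred_eq, Finset.sum_add_distrib, Finset.sum_ite_mem, Finset.univ_inter,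
    Finset.sum_const, nsmul_eq_mul] at hle
  have : 0 < (U.card : ℝ) * η := mul_pos (by exact_mod_cast hne.card_pos) hpos
  linarith

/-- The tight constraints of `exists_maximal_potential` contain a spanning forest. -/
lemma exists_rank_of_tight {x : V → ℝ}
    (h : ∀ U ⊆ S, U.Nonempty → ∃ v ∈ U, x v = c v ∨ ∃ u ∉ U, E v u ∧ x v = x u + w v u) :
    ∃ rank : V → ℕ, ∀ v ∈ S, rank v < S.card ∧
      (x v = c v ∨ ∃ u, E v u ∧ x v = x u + w v u ∧ (u ∉ S ∨ rank u < rank v)) := by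
  classical
  -- The forest grows one vertex at a time: the hypothesis applied to `S \ G` yields a vertex whose
  -- tight constraint ends in `G` or outside `S`. Its rank is its time of insertion.
  suffices H : ∀ m ≤ S.card, ∃ G ⊆ S, G.card = m ∧ ∃ rank : V → ℕ, ∀ v ∈ G, rank v < m ∧
      (x v = c v ∨ ∃ u, E v u ∧ x v = x u + w v u ∧ (u ∉ S ∨ u ∈ G ∧ rank u < rank v)) by
    obtain ⟨G, hG, hcard, rank, hr⟩ := H _ le_rfl
    obtain rfl := Finset.eq_of_subset_of_card_le hG hcard.ge
    refine ⟨rank, fun v hv => ⟨(hr v hv).1, (hr v hv).2.imp_right ?_⟩⟩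
    rintro ⟨u, h1, h2, h3⟩
    exact ⟨u, h1, h2, h3.imp_right And.right⟩
  intro m
  induction m with
  | zero => exact fun _ => ⟨∅, by simp, by simp, fun _ => 0, by simp⟩
  | succ m ih =>
    intro hm
    obtain ⟨G, hG, hcard, rank, hr⟩ := ih (by omega)
    have hne : (S \ G).Nonempty := by
      rw [← Finset.card_pos, Finset.card_sdiff_of_subset hG]; omega
    obtain ⟨v, hv, htight⟩ := h (S \ G) Finset.sdiff_subset hne
    obtain ⟨hvS, hvG⟩ := Finset.mem_sdiff.1 hv
    refine ⟨insert v G, Finset.insert_subset hvS hG, by simp [hvG, hcard],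
      Function.update rank v m, fun v' hv' => ?_⟩
    have hrank : ∀ u ∈ G, Function.update rank v m u = rank u := fun u hu =>
      Function.update_of_ne (by rintro rfl; exact hvG hu) _ _
    rcases Finset.mem_insert.1 hv' with rfl | hv'
    · refine ⟨by simp, htight.imp_right ?_⟩
      rintro ⟨u, hu, h1, h2⟩
      refine ⟨u, h1, h2, ?_⟩
      by_cases huS : u ∈ S
      · have huG : u ∈ G := by simpa [huS] using hu
        exact .inr ⟨Finset.mem_insert_of_mem huG, by simpa [hrank u huG] using (hr u huG).1⟩
      · exact .inl huS
    · rw [hrank v' hv']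
      refine ⟨(hr v' hv').1.trans (Nat.lt_succ_self m), (hr v' hv').2.imp_right ?_⟩
      rintro ⟨u, h1, h2, h3⟩
      refine ⟨u, h1, h2, h3.imp_right ?_⟩
      rintro ⟨huG, hlt⟩
      exact ⟨Finset.mem_insert_of_mem huG, by rwa [hrank u huG]⟩

end Potentials

/-! ### Sign of an affine function near zero -/

/-- The affine function `δ ↦ a + b * δ` is nonnegative for all small positive `δ`. -/
def LexNonneg (a b : ℝ) : Prop := ¬ a < 0 ∧ ¬ (¬ 0 < a ∧ b < 0)

/-- By continuity the sign of `a` decides near zero; if `a = 0`, the sign of `b` does. -/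
lemma eventually_nonneg_iff (a b : ℝ) : ∀ᶠ δ : ℝ in 𝓝[>] 0, (0 ≤ a + b * δ ↔ LexNonneg a b) := by
  have hlim : Tendsto (fun δ : ℝ => a + b * δ) (𝓝[>] 0) (𝓝 a) := by
    have : Continuous fun δ : ℝ => a + b * δ := by fun_prop
    simpa using (this.tendsto 0).mono_left nhdsWithin_le_nhds
  rcases lt_trichotomy a 0 with ha | rfl | ha
  · filter_upwards [hlim.eventually_lt_const ha] with δ hδ
    simp [LexNonneg, ha, hδ]
  · filter_upwards [self_mem_nhdsWithin] with δ hδ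
    have hδ : 0 < δ := hδ
    simp [LexNonneg, mul_nonneg_iff_of_pos_right hδ]
  · filter_upwards [hlim.eventually_const_lt ha] with δ hδ
    simp [LexNonneg, ha, ha.le, hδ.le]

/-! ### Candidate radii -/

/-- For every vertex an upper potential `pa + pb * δ` and a lower potential `qa + qb * δ`. -/
structure Potentials where
  (pa pb qa qb : ℕ → ℝ)

namespace Potentials

def up (V : Potentials) (δ : ℝ) (i : ℕ) : ℝ := V.pa i + V.pb i * δ

def down (V : Potentials) (δ : ℝ) (i : ℕ) : ℝ := V.qa i + V.qb i * δ

/-- The potentials of a disk of radius `1`. -/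
def unit : Potentials := ⟨fun _ => 1, fun _ => 0, fun _ => 0 - 1, fun _ => 0⟩

open Function in
/-- Make the upper bound `hi` tight for `i` (if `i = j`), or the condition that the disks `i` and
`j` are disjoint. -/
def stepUp (d : ℕ → ℕ → ℝ) (hi : ℝ) (i j : ℕ) (V : Potentials) : Potentials :=
  if i = j then { V with pa := update V.pa i hi, pb := update V.pb i 0 }
  else { V with pa := update V.pa i (V.qa j + d i j), pb := update V.pb i (V.qb j - 1) }

open Function in
/-- Make the lower bound `lo` tight for `i` (if `i = j`), or the condition that the disks `i` and
`j` intersect. -/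
def stepDown (d : ℕ → ℕ → ℝ) (lo : ℝ) (i j : ℕ) (V : Potentials) : Potentials :=
  if i = j then { V with qa := update V.qa i (0 - lo), qb := update V.qb i 0 }
  else { V with qa := update V.qa i (V.pa j - d i j), qb := update V.qb i (V.pb j) }

variable (d : ℕ → ℕ → ℝ) (lo hi : ℝ) (t p q : ℕ → ℕ)

/-- One round of updates for the vertices `t 0, …, t (m - 1)` with partners `p` and `q`. -/
def sweep : ℕ → Potentials → Potentials
  | 0, V => V
  | m + 1, V => stepDown d lo (t m) (q m) (stepUp d hi (t m) (p m) (sweep m V))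

variable {d lo hi t p q}

/-- At a fixed `δ` the updates of coefficient pairs become updates of real values, the form in which
convergence is proved. -/
lemma up_stepUp (V : Potentials) (δ : ℝ) (i j : ℕ) : (stepUp d hi i j V).up δ =
    Function.update (V.up δ) i (if i = j then hi else V.down δ j + d i j - δ) := by
  ext l
  by_cases hl : l = i <;> by_cases hij : i = j <;>
    simp [stepUp, up, down, hl, hij, Function.update_apply]
  · ring
  · simp_all

@[simp] lemma down_stepUp (V : Potentials) (δ : ℝ) (i j : ℕ) :
    (stepUp d hi i j V).down δ = V.down δ := by
  ext l
  by_cases hij : i = j <;> simp [stepUp, down, hij]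

lemma down_stepDown (V : Potentials) (δ : ℝ) (i j : ℕ) : (stepDown d lo i j V).down δ =
    Function.update (V.down δ) i (if i = j then -lo else V.up δ j - d i j) := by
  ext l
  by_cases hl : l = i <;> by_cases hij : i = j <;>
    simp [stepDown, up, down, hl, hij, Function.update_apply]
  · ring
  · simp_all

@[simp] lemma up_stepDown (V : Potentials) (δ : ℝ) (i j : ℕ) :
    (stepDown d lo i j V).up δ = V.up δ := by
  ext l
  by_cases hij : i = j <;> simp [stepDown, up, hij]

/-- If `X` and `Y` satisfy the equations imposed by the updates, in a noncyclic way, then the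
potentials converge to them. -/
lemma iterate_sweep_eq {δ : ℝ} {X Y : ℕ → ℝ} {ρ ρ' : ℕ → ℕ} {k R : ℕ}
    (hX₁ : ∀ i, (∀ m < k, t m ≠ i) → X i = 1) (hY₁ : ∀ i, (∀ m < k, t m ≠ i) → Y i = -1)
    (hX : ∀ m < k, ρ (t m) < R ∧ ((t m = p m ∧ X (t m) = hi) ∨
      (t m ≠ p m ∧ X (t m) = Y (p m) + d (t m) (p m) - δ ∧
        ((∀ m' < k, t m' ≠ p m) ∨ ρ' (p m) < ρ (t m)))))
    (hY : ∀ m < k, ρ' (t m) < R ∧ ((t m = q m ∧ Y (t m) = -lo) ∨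
      (t m ≠ q m ∧ Y (t m) = X (q m) - d (t m) (q m) ∧
        ((∀ m' < k, t m' ≠ q m) ∨ ρ (q m) < ρ' (t m))))) :
    ((sweep d lo hi t p q k)^[R] unit).up δ = X ∧
      ((sweep d lo hi t p q k)^[R] unit).down δ = Y := by
  -- A potential is correct in round `r`, after `m` updates, if its vertex is not rescaled, if its
  -- rank is below `r`, or if its rank is `r` and it was already updated in this round. Other
  -- potentials may hold arbitrary values.
  set Settled : (ℕ → ℕ) → ℕ → ℕ → ℕ → Prop := fun ρ r m i =>
    (∀ m' < k, t m' ≠ i) ∨ ρ i < r ∨ (ρ i ≤ r ∧ ∃ m' < m, t m' = i) with hS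
  set Ok : ℕ → ℕ → Potentials → Prop := fun r m V =>
    (∀ i, Settled ρ r m i → V.up δ i = X i) ∧ ∀ i, Settled ρ' r m i → V.down δ i = Y i with hOk
  have hnew : ∀ {σ : ℕ → ℕ} {r m i : ℕ}, i ≠ t m → Settled σ r (m + 1) i → Settled σ r m i := by
    rintro σ r m i hi (h | h | ⟨h, m', hm', h'⟩)
    · exact .inl h
    · exact .inr (.inl h)
    · refine .inr (.inr ⟨h, m', ?_, h'⟩)
      rcases Nat.lt_succ_iff_lt_or_eq.1 hm' with h1 | rfl
      · exact h1
      · exact absurd h'.symm hi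
  have hold : ∀ {σ : ℕ → ℕ} {r m : ℕ}, m < k → Settled σ r (m + 1) (t m) → σ (t m) ≤ r := by
    rintro σ r m hm (h | h | ⟨h, -⟩)
    · exact absurd rfl (h m hm)
    · exact h.le
    · exact h
  have hsweep : ∀ r V, Ok r 0 V → ∀ m ≤ k, Ok r m (sweep d lo hi t p q m V) := by
    intro r V hV m
    induction m with
    | zero => exact fun _ => hV
    | succ m ih =>
      intro hm
      obtain ⟨h1, h2⟩ := ih (by omega)
      set W := sweep d lo hi t p q m V with hW
      have h1' : ∀ i, Settled ρ r (m + 1) i →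
          (stepUp d hi (t m) (p m) W).up δ i = X i := by
        intro i hi
        rw [up_stepUp]
        by_cases hit : i = t m
        · subst hit
          have hr := hold (by omega) hi
          rw [Function.update_self]
          rcases (hX m (by omega)).2 with ⟨ha, hb⟩ | ⟨ha, hb, hc⟩
          · rw [if_pos ha, hb]
          · rw [if_neg ha, hb, h2 _ (hc.imp_right fun h => .inl (by omega))]
        · rw [Function.update_of_ne hit]
          exact h1 i (hnew hit hi)
      refine ⟨by simpa only [sweep, ← hW, up_stepDown] using h1', fun i hi => ?_⟩
      rw [sweep, ← hW, down_stepDown, down_stepUp]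
      by_cases hit : i = t m
      · subst hit
        have hr := hold (by omega) hi
        rw [Function.update_self]
        rcases (hY m (by omega)).2 with ⟨ha, hb⟩ | ⟨ha, hb, hc⟩
        · rw [if_pos ha, hb]
        · rw [if_neg ha, hb, h1' _ (hc.imp_right fun h => .inl (by omega))]
      · rw [Function.update_of_ne hit]
        exact h2 i (hnew hit hi)
  have hround : ∀ r, Ok r 0 ((sweep d lo hi t p q k)^[r] unit) := by
    intro r
    induction r with
    | zero =>
      refine ⟨fun i hi => ?_, fun i hi => ?_⟩
      · rcases hi with h | h | ⟨-, m, hm, -⟩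
        · simp [unit, up, hX₁ i h]
        · omega
        · omega
      · rcases hi with h | h | ⟨-, m, hm, -⟩
        · simp [unit, down, hY₁ i h]
        · omega
        · omega
    | succ r ih =>
      rw [Function.iterate_succ_apply']
      -- A full sweep has updated every rescaled vertex, so rank `r` is settled when round `r + 1`
      -- starts.
      have hnext : ∀ {σ : ℕ → ℕ} {i : ℕ}, Settled σ (r + 1) 0 i → Settled σ r k i := by
        rintro σ i (h | h | ⟨-, m, hm, -⟩)
        · exact .inl h
        · by_cases hi : ∀ m' < k, t m' ≠ i
          · exact .inl hi
          · push Not at hi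
            exact .inr (.inr ⟨by omega, hi⟩)
        · omega
      obtain ⟨h1, h2⟩ := hsweep r _ ih k le_rfl
      exact ⟨fun i hi => h1 i (hnext hi), fun i hi => h2 i (hnext hi)⟩
  have hall : ∀ {σ : ℕ → ℕ}, (∀ m < k, σ (t m) < R) → ∀ i, Settled σ R 0 i := by
    intro σ hσ i
    by_cases hi : ∀ m' < k, t m' ≠ i
    · exact .inl hi
    · push Not at hi
      obtain ⟨m, hm, rfl⟩ := hi
      exact .inr (.inl (hσ m hm))
  obtain ⟨h1, h2⟩ := hround R
  exact ⟨funext fun i => h1 i (hall (fun m hm => (hX m hm).1) i),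
    funext fun i => h2 i (hall (fun m hm => (hY m hm).1) i)⟩

/-- Vertices that are not rescaled keep radius `1`. -/
lemma iterate_sweep_unit (δ : ℝ) {k i : ℕ} (R : ℕ) (hi' : ∀ m < k, t m ≠ i) :
    ((sweep d lo hi t p q k)^[R] unit).up δ i = 1 ∧
      ((sweep d lo hi t p q k)^[R] unit).down δ i = -1 := by
  have hsweep : ∀ V : Potentials, V.up δ i = 1 ∧ V.down δ i = -1 → ∀ m ≤ k,
      (sweep d lo hi t p q m V).up δ i = 1 ∧ (sweep d lo hi t p q m V).down δ i = -1 := by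
    intro V hV m
    induction m with
    | zero => exact fun _ => hV
    | succ m ih =>
      intro hm
      have hne := (hi' m (by omega)).symm
      rw [sweep, up_stepDown, up_stepUp, down_stepDown, down_stepUp, Function.update_of_ne hne,
        Function.update_of_ne hne]
      exact ih (by omega)
  induction R with
  | zero => simp [unit, up, down]
  | succ R ih =>
    rw [Function.iterate_succ_apply']
    exact hsweep _ ih k le_rfl

end Potentials

/-! ### Soundness and completeness of the candidates -/

namespace ScalingInstance

variable (I : ScalingInstance)

/-- The distance of two points, computed from their coordinates. -/
noncomputable def ptDist (i j : ℕ) : ℝ :=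
  √(((scalingStore I).real 1 i - (scalingStore I).real 1 j) *
      ((scalingStore I).real 1 i - (scalingStore I).real 1 j) +
    ((scalingStore I).real 2 i - (scalingStore I).real 2 j) *
      ((scalingStore I).real 2 i - (scalingStore I).real 2 j))

lemma ptDist_comm (i j : ℕ) : I.ptDist i j = I.ptDist j i := by
  unfold ptDist; congr 1; ring

lemma ptDist_eq (i j : Fin I.n) : I.ptDist i j = dist (I.pt i) (I.pt j) := by
  rw [EuclideanSpace.dist_eq, ptDist]
  simp [scalingStore, Fin.sum_univ_two, Real.dist_eq, sq]

/-- The potentials described by the digits `D`: `D m`, `D (m + k)` and `D (m + 2 * k)` are the `m`th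
vertex and its partners. -/
noncomputable def candidate (D : ℕ → ℕ) : Potentials :=
  (Potentials.sweep I.ptDist I.rmin I.rmax D (fun m => D (m + I.k)) (fun m => D (m + I.k + I.k))
    I.k)^[I.k + I.k] Potentials.unit

/-- The radii that belong to given potentials. -/
noncomputable def radius (V : Potentials) (δ : ℝ) (i : ℕ) : ℝ := (V.up δ i - V.down δ i) / 2

/-- Adjacency in the disk graph for all small positive `δ`. -/
def LexAdj (V : Potentials) (i j : ℕ) : Prop :=
  i ≠ j ∧ LexNonneg (V.pa i - V.qa i + (V.pa j - V.qa j) - (I.ptDist i j + I.ptDist i j))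
    (V.pb i - V.qb i + (V.pb j - V.qb j))

/-- The disk graph of the radii that belong to given potentials, for all small positive `δ`. -/
def lexGraph (V : Potentials) : SimpleGraph (Fin I.n) where
  Adj i j := I.LexAdj V i j
  symm := ⟨fun i j h => ⟨h.1.symm, by rw [I.ptDist_comm j i]; convert h.2 using 1 <;> ring⟩⟩
  loopless := ⟨fun _ h => h.1 rfl⟩

/-- The radius of vertex `i` is between `rmin` and `rmax` for all small positive `δ`. -/
def LexBounded (V : Potentials) (i : ℕ) : Prop :=
  LexNonneg (V.pa i - V.qa i - (I.rmin + I.rmin)) (V.pb i - V.qb i) ∧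
    LexNonneg (I.rmax + I.rmax - (V.pa i - V.qa i)) (V.qb i - V.pb i)

/-- The potentials described by `D` give a solution for all small positive `δ`. -/
def Valid (C : GraphClass) (D : ℕ → ℕ) : Prop :=
  (∀ m < I.k, I.LexBounded (I.candidate D) (D m)) ∧ C.Mem (I.lexGraph (I.candidate D))

/-- The potentials described by `D` give a solution for `δ`. -/
def ValidAt (C : GraphClass) (D : ℕ → ℕ) (δ : ℝ) : Prop :=
  (∀ m < I.k, I.rmin ≤ radius (I.candidate D) δ (D m) ∧
    radius (I.candidate D) δ (D m) ≤ I.rmax) ∧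
  C.Mem (diskGraph I.pt fun i => radius (I.candidate D) δ i)

/-- Validity depends on finitely many signs of affine functions of `δ`. The inequalities are doubled
in `LexAdj` and `LexBounded` to clear the denominator of `radius`. -/
lemma eventually_validAt_iff (C : GraphClass) (D : ℕ → ℕ) :
    ∀ᶠ δ : ℝ in 𝓝[>] 0, (I.ValidAt C D δ ↔ I.Valid C D) := by
  set V := I.candidate D with hV
  have h1 : ∀ᶠ δ : ℝ in 𝓝[>] 0, ∀ i j : Fin I.n, (0 ≤ (V.pa i - V.qa i + (V.pa j - V.qa j) -
      (I.ptDist i j + I.ptDist i j)) + (V.pb i - V.qb i + (V.pb j - V.qb j)) * δ ↔ LexNonneg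
        (V.pa i - V.qa i + (V.pa j - V.qa j) - (I.ptDist i j + I.ptDist i j))
        (V.pb i - V.qb i + (V.pb j - V.qb j))) := by
    simp only [eventually_all]
    exact fun i j => eventually_nonneg_iff _ _
  have h2 : ∀ᶠ δ : ℝ in 𝓝[>] 0, ∀ m : Fin I.k,
      (I.rmin ≤ radius V δ (D m) ∧ radius V δ (D m) ≤ I.rmax ↔ I.LexBounded V (D m)) := by
    simp only [eventually_all]
    intro m
    filter_upwards [eventually_nonneg_iff (V.pa (D m) - V.qa (D m) - (I.rmin + I.rmin))
      (V.pb (D m) - V.qb (D m)), eventually_nonneg_iff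
      (I.rmax + I.rmax - (V.pa (D m) - V.qa (D m))) (V.qb (D m) - V.pb (D m))] with δ ha hb
    rw [LexBounded, ← ha, ← hb, radius, Potentials.up, Potentials.down]
    refine and_congr ?_ ?_ <;> constructor <;> intro h <;> linarith
  filter_upwards [h1, h2] with δ h1 h2
  have hG : I.lexGraph V = diskGraph I.pt fun i => radius V δ i := by
    ext i j
    change I.LexAdj V i j ↔ i ≠ j ∧ dist (I.pt i) (I.pt j) ≤ radius V δ i + radius V δ j
    rw [LexAdj, ← h1, ← I.ptDist_eq, radius, radius, Fin.val_ne_iff]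
    simp only [Potentials.up, Potentials.down]
    refine and_congr Iff.rfl ?_
    constructor <;> intro h <;> linarith
  rw [ValidAt, Valid, ← hV, hG]
  exact and_congr ⟨fun h m hm => (h2 ⟨m, hm⟩).1 (h m hm), fun h m hm => (h2 ⟨m, hm⟩).2 (h m hm)⟩
    Iff.rfl

/-- Soundness needs nothing about the partners: whatever radii they produce have been checked.
Repeated vertex digits and those that are at least `n` only make the rescaled set smaller. -/
lemma yes_of_validAt {C : GraphClass} {D : ℕ → ℕ} {δ : ℝ} (h : I.ValidAt C D δ) :
    C.scaling.Yes I := by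
  classical
  refine ⟨Finset.univ.filter fun i => ∃ m < I.k, D m = i, fun i => radius (I.candidate D) δ i,
    ?_, ?_, ?_, ?_, h.2⟩
  · intro i
    by_cases hi : ∃ m < I.k, D m = i
    · obtain ⟨m, hm, hi⟩ := hi
      have := (h.1 m hm).1
      rw [hi] at this
      exact I.rmin_pos.trans_le this
    · push Not at hi
      obtain ⟨h1, h2⟩ := Potentials.iterate_sweep_unit (d := I.ptDist) (lo := I.rmin)
        (hi := I.rmax) (p := fun m => D (m + I.k)) (q := fun m => D (m + I.k + I.k)) δ
        (I.k + I.k) hi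
      change 0 < radius _ δ i
      rw [radius, candidate, h1, h2]; norm_num
  · calc _ = ((Finset.univ.filter fun i : Fin I.n => ∃ m < I.k, D m = i).map
            Fin.valEmbedding).card := (Finset.card_map _).symm
      _ ≤ ((Finset.range I.k).image D).card := by
          refine Finset.card_le_card fun i hi => ?_
          simp only [Finset.mem_map, Finset.mem_filter, Finset.mem_univ, true_and] at hi
          obtain ⟨i', ⟨m, hm, h'⟩, rfl⟩ := hi
          exact Finset.mem_image.2 ⟨m, Finset.mem_range.2 hm, h'⟩
      _ ≤ I.k := Finset.card_image_le.trans (by simp)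
  · intro i hi
    obtain ⟨m, hm, hi⟩ := (Finset.mem_filter.1 hi).2
    have := h.1 m hm
    rwa [hi] at this
  · intro i hi
    have hi : ∀ m < I.k, D m ≠ i := by simpa using hi
    obtain ⟨h1, h2⟩ := Potentials.iterate_sweep_unit (d := I.ptDist) (lo := I.rmin)
      (hi := I.rmax) (p := fun m => D (m + I.k)) (q := fun m => D (m + I.k + I.k)) δ
      (I.k + I.k) hi
    change radius _ δ i = 1
    rw [radius, candidate, h1, h2]; norm_num

/-- The optimal potentials for a given solution and a given `δ`, and the structure of their tight
constraints. -/
lemma exists_tight_potentials {T : Finset (Fin I.n)} {r : Fin I.n → ℝ}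
    (hT : ∀ i ∈ T, I.rmin ≤ r i ∧ r i ≤ I.rmax) {δ : ℝ} (hδ : 0 < δ)
    (hsep : ∀ i j, i ≠ j → ¬ (diskGraph I.pt r).Adj i j → r i + r j ≤ I.ptDist i j - δ) :
    ∃ x y : Fin I.n → ℝ, (∀ i ∉ T, x i = r i ∧ y i = - r i) ∧
      (∀ i ∈ T, I.rmin ≤ (x i - y i) / 2 ∧ (x i - y i) / 2 ≤ I.rmax) ∧
      diskGraph I.pt (fun i => (x i - y i) / 2) = diskGraph I.pt r ∧
      ∃ (ρ ρ' : Fin I.n → ℕ) (p q : Fin I.n → Fin I.n), ∀ i ∈ T,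
        (ρ i < T.card + T.card ∧ ((i = p i ∧ x i = I.rmax) ∨ (i ≠ p i ∧
          x i = y (p i) + I.ptDist i (p i) - δ ∧ (p i ∉ T ∨ ρ' (p i) < ρ i)))) ∧
        (ρ' i < T.card + T.card ∧ ((i = q i ∧ y i = -I.rmin) ∨ (i ≠ q i ∧
          y i = x (q i) - I.ptDist i (q i) ∧ (q i ∉ T ∨ ρ (q i) < ρ' i)))) := by
  classical
  set G := diskGraph I.pt r with hG
  -- Variable `(i, true)` is the upper potential of `i` and `(i, false)` the lower one. Edges of `G`
  -- constrain lower potentials by upper ones, non-edges the reverse; the start `z₀` is the given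
  -- solution.
  set S : Finset (Fin I.n × Bool) := T ×ˢ Finset.univ with hS
  set c : Fin I.n × Bool → ℝ := fun v => if v.2 then I.rmax else -I.rmin with hc
  set E : Fin I.n × Bool → Fin I.n × Bool → Prop := fun v u =>
    v.1 ≠ u.1 ∧ v.2 ≠ u.2 ∧ (G.Adj v.1 u.1 ↔ v.2 = false) with hE
  set w : Fin I.n × Bool → Fin I.n × Bool → ℝ := fun v u =>
    if v.2 then I.ptDist v.1 u.1 - δ else - I.ptDist v.1 u.1 with hw
  set z₀ : Fin I.n × Bool → ℝ := fun v => if v.2 then r v.1 else - r v.1 with hz₀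
  have hadj : ∀ i j, G.Adj i j → I.ptDist i j ≤ r i + r j := fun i j h => by
    rw [I.ptDist_eq]; exact h.2
  obtain ⟨z, h1, h2, h3, h4, h5⟩ := exists_maximal_potential (S := S) (c := c) (E := E) (w := w)
    (x₀ := z₀) (by
      rintro ⟨i, _ | _⟩ hv
      · simpa [hc, hz₀] using (hT i (by simpa [hS] using hv)).1
      · simpa [hc, hz₀] using (hT i (by simpa [hS] using hv)).2) (by
      rintro ⟨i, _ | _⟩ ⟨j, _ | _⟩ ⟨ha, hb, he⟩
      · simp at hb
      · have := hadj i j (he.2 rfl)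
        simp only [hz₀, hw]; simp; linarith
      · have := hsep i j ha (fun h => by simpa using he.1 h)
        simp only [hz₀, hw]; simp; linarith
      · simp at hb)
  obtain ⟨rank, hrank⟩ := exists_rank_of_tight h5
  have hcard : S.card = T.card + T.card := by simp [hS, mul_two]
  have hmem : ∀ i b, (i, b) ∈ S ↔ i ∈ T := by simp [hS]
  refine ⟨fun i => z (i, true), fun i => z (i, false), ?_, ?_, ?_, fun i => rank (i, true),
    fun i => rank (i, false), ?_⟩
  · intro i hi
    exact ⟨by simpa [hz₀] using h2 (i, true) (by simpa [hmem] using hi),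
      by simpa [hz₀] using h2 (i, false) (by simpa [hmem] using hi)⟩
  · intro i hi
    -- Here the lower bound `z₀ ≤ z` is needed: it gives `x i ≥ rmin` and `y i ≥ -rmax`, the two
    -- bounds absent from `c`.
    have a1 : z (i, true) ≤ I.rmax := by simpa [hc] using h3 (i, true) ((hmem _ _).2 hi)
    have a2 : z (i, false) ≤ -I.rmin := by simpa [hc] using h3 (i, false) ((hmem _ _).2 hi)
    have a3 : r i ≤ z (i, true) := by simpa [hz₀] using h1 (i, true)
    have a4 : - r i ≤ z (i, false) := by simpa [hz₀] using h1 (i, false)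
    have := hT i hi
    constructor <;> dsimp only <;> linarith
  · ext i j
    change (i ≠ j ∧ dist (I.pt i) (I.pt j) ≤ _) ↔ G.Adj i j
    by_cases hij : i = j
    · simp [hij]
    rw [← I.ptDist_eq]
    by_cases hG' : G.Adj i j
    -- The constraints for `(i, j)` and `(j, i)` add up to the inequality for the averaged radii.
    · have a1 := h4 (i, false) (j, true) ⟨hij, by simp, by simpa using hG'⟩
      have a2 := h4 (j, false) (i, true) ⟨Ne.symm hij, by simp, by simpa using hG'.symm⟩
      simp only [hw, Bool.false_eq_true, if_false] at a1 a2
      rw [I.ptDist_comm j i] at a2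
      refine iff_of_true ⟨hij, ?_⟩ hG'
      linarith
    · have hG'' : ¬ G.Adj j i := fun h => hG' h.symm
      have a1 := h4 (i, true) (j, false) ⟨hij, by simp, by simpa using hG'⟩
      have a2 := h4 (j, true) (i, false) ⟨Ne.symm hij, by simp, by simpa using hG''⟩
      simp only [hw, if_true] at a1 a2
      rw [I.ptDist_comm j i] at a2
      refine iff_of_false (fun h => ?_) hG'
      have := h.2
      linarith
  · have key : ∀ v : Fin I.n × Bool, ∃ p : Fin I.n, v ∈ S → rank v < S.card ∧
        ((v.1 = p ∧ z v = c v) ∨ (v.1 ≠ p ∧ z v = z (p, !v.2) + w v (p, !v.2) ∧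
          (p ∉ T ∨ rank (p, !v.2) < rank v))) := by
      intro v
      by_cases hv : v ∈ S
      · obtain ⟨hr, htight | ⟨⟨j, b⟩, he, hz, hlt⟩⟩ := hrank v hv
        · exact ⟨v.1, fun _ => ⟨hr, .inl ⟨rfl, htight⟩⟩⟩
        · obtain rfl : b = !v.2 := by
            have := he.2.1
            cases hb : v.2 <;> cases b <;> simp_all
          exact ⟨j, fun _ => ⟨hr, .inr ⟨he.1, hz, by rwa [hmem] at hlt⟩⟩⟩
      · exact ⟨v.1, fun h => absurd h hv⟩
    choose p hp using key
    refine ⟨fun i => p (i, true), fun i => p (i, false), fun i hi => ⟨?_, ?_⟩⟩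
    · have := hp (i, true) ((hmem _ _).2 hi)
      rw [hcard] at this
      simpa [hc, hw, add_sub_assoc] using this
    · have := hp (i, false) ((hmem _ _).2 hi)
      rw [hcard] at this
      simpa [hc, hw, ← sub_eq_add_neg] using this

/-- Every solution gives rise to digits that are valid at all small positive `δ`. -/
lemma exists_validAt {C : GraphClass} {T : Finset (Fin I.n)} {r : Fin I.n → ℝ}
    (hcard : T.card ≤ I.k) (hT : ∀ i ∈ T, I.rmin ≤ r i ∧ r i ≤ I.rmax) (hT' : ∀ i ∉ T, r i = 1)
    (hC : C.Mem (diskGraph I.pt r)) {δ : ℝ} (hδ : 0 < δ)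
    (hsep : ∀ i j, i ≠ j → ¬ (diskGraph I.pt r).Adj i j → r i + r j ≤ I.ptDist i j - δ) :
    ∃ D : ℕ → ℕ, (∀ j, D j < I.n + 2) ∧ (∀ j, I.k + I.k + I.k ≤ j → D j = 0) ∧
      I.ValidAt C D δ := by
  classical
  obtain ⟨x, y, h1, h2, h3, ρ, ρ', p, q, hpq⟩ := I.exists_tight_potentials hT hδ hsep
  set e := T.equivFin with he
  -- When `T` has fewer than `k` elements, the spare slots hold the dummy vertex `n`.
  set t : ℕ → ℕ := fun m => if h : m < T.card then ((e.symm ⟨m, h⟩ : T) : Fin I.n) else I.n with ht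
  set ext : (Fin I.n → Fin I.n) → ℕ → ℕ := fun p i => if h : i < I.n then p ⟨i, h⟩ else I.n with hext
  have htT : ∀ m, t m = I.n ∨ ∃ i ∈ T, t m = (i : ℕ) := by
    intro m
    by_cases h : m < T.card
    · exact .inr ⟨_, (e.symm ⟨m, h⟩).2, by simp [ht, h]⟩
    · exact .inl (by simp [ht, h])
  have hrange : ∀ i : Fin I.n, (∀ m < I.k, t m ≠ i) ↔ i ∉ T := by
    intro i
    constructor
    · intro h hi
      refine h (e ⟨i, hi⟩) ((e ⟨i, hi⟩).2.trans_le hcard) ?_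
      simp [ht]
    · intro hi m _ hm
      rcases htT m with h | ⟨i', hi', h⟩
      · have := i.2; omega
      · exact hi (by rwa [Fin.ext (hm.symm.trans h)])
  have hext_lt : ∀ p i, ext p i ≤ I.n := by
    intro p i
    by_cases h : i < I.n
    · simp [hext, h]
    · simp [hext, h]
  have ht_le : ∀ m, t m ≤ I.n := by
    intro m
    rcases htT m with h | ⟨i, -, h⟩ <;> rw [h]
    exact i.2.le
  set D : ℕ → ℕ := fun j => if j < I.k then t j else if j < I.k + I.k then ext p (t (j - I.k)) else
    if j < I.k + I.k + I.k then ext q (t (j - (I.k + I.k))) else 0 with hD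
  have hD1 : ∀ m < I.k, D m = t m := fun m hm => by simp [hD, hm]
  have hD2 : ∀ m < I.k, D (m + I.k) = ext p (t m) := fun m hm => by simp [hD, hm]
  have hD3 : ∀ m < I.k, D (m + I.k + I.k) = ext q (t m) := fun m hm => by
    simp only [hD]
    rw [if_neg (by omega), if_neg (by omega), if_pos (by omega),
      show m + I.k + I.k - (I.k + I.k) = m by omega]
  -- The dummy vertex is its own partner, so both its bounds are tight: its potentials are `rmax`
  -- and `-rmin`, and its radius `(rmax + rmin) / 2` passes the bound check. Indices that do not
  -- occur keep the unit potentials.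
  set toNat : (Fin I.n → ℝ) → ℝ → ℝ → ℕ → ℝ := fun x a b i => if h : i < I.n then x ⟨i, h⟩ else
    if ∃ m < I.k, D m = i then a else b with htoNat
  have htoNat_fin : ∀ x a b (i : Fin I.n), toNat x a b i = x i := fun x a b i => by simp [htoNat]
  have htoNat_n : ∀ x a b, ∀ m < I.k, t m = I.n → toNat x a b (t m) = a := fun x a b m hm h => by
    simp only [htoNat, h, lt_irrefl, dite_false]
    exact if_pos ⟨m, hm, by rw [hD1 m hm, h]⟩
  set rk : (Fin I.n → ℕ) → ℕ → ℕ := fun ρ i => if h : i < I.n then ρ ⟨i, h⟩ else 0 with hrk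
  have hrk_fin : ∀ ρ (i : Fin I.n), rk ρ i = ρ i := fun ρ i => by simp [hrk]
  have hext_fin : ∀ p (i : Fin I.n), ext p i = p i := fun p i => by simp [hext]
  have hrange' : ∀ i : Fin I.n, (∀ m < I.k, D m ≠ i) ↔ i ∉ T := by
    intro i
    rw [← hrange]
    exact ⟨fun h m hm => hD1 m hm ▸ h m hm, fun h m hm => (hD1 m hm).symm ▸ h m hm⟩
  -- Ranks are below `2 * T.card ≤ 2 * k`, so `2 * k` rounds suffice.
  have hval := Potentials.iterate_sweep_eq (d := I.ptDist) (lo := I.rmin) (hi := I.rmax) (t := D)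
    (p := fun m => D (m + I.k)) (q := fun m => D (m + I.k + I.k)) (δ := δ)
    (X := toNat x I.rmax 1) (Y := toNat y (-I.rmin) (-1)) (ρ := rk ρ) (ρ' := rk ρ')
    (k := I.k) (R := I.k + I.k) ?_ ?_ ?_ ?_
  · refine ⟨D, ?_, ?_, ?_⟩
    · intro j
      have a1 := ht_le j
      have a2 := hext_lt p (t (j - I.k))
      have a3 := hext_lt q (t (j - (I.k + I.k)))
      simp only [hD]
      split_ifs <;> omega
    · intro j hj
      simp only [hD]
      rw [if_neg (by omega), if_neg (by omega), if_neg (by omega)]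
    · have hrad : ∀ i, radius (I.candidate D) δ i =
          (toNat x I.rmax 1 i - toNat y (-I.rmin) (-1) i) / 2 := by
        intro i
        rw [radius, candidate, hval.1, hval.2]
      refine ⟨fun m hm => ?_, ?_⟩
      · rw [hrad, hD1 m hm]
        rcases htT m with h | ⟨i, hi, h⟩
        · rw [htoNat_n _ _ _ m hm h, htoNat_n _ _ _ m hm h]
          have := I.rmin_le_rmax
          constructor <;> linarith
        · rw [h, htoNat_fin, htoNat_fin]
          exact h2 i hi
      · simp only [hrad, htoNat_fin]
        rwa [h3]
  · intro i hi
    by_cases hn : i < I.n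
    · have hi' := (hrange' ⟨i, hn⟩).1 hi
      simp [htoNat, hn, (h1 _ hi').1, hT' _ hi']
    · have : ¬ ∃ m < I.k, D m = i := by push Not; exact hi
      simp only [htoNat, hn, dite_false, this, if_false]
  · intro i hi
    by_cases hn : i < I.n
    · have hi' := (hrange' ⟨i, hn⟩).1 hi
      simp [htoNat, hn, (h1 _ hi').2, hT' _ hi']
    · have : ¬ ∃ m < I.k, D m = i := by push Not; exact hi
      simp only [htoNat, hn, dite_false, this, if_false]
  · intro m hm
    rw [hD2 m hm, hD1 m hm]
    rcases htT m with h | ⟨i, hi, h⟩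
    · refine ⟨?_, .inl ⟨?_, htoNat_n _ _ _ m hm h⟩⟩
      · simp [h, hrk]; omega
      · simp [h, hext]
    · simp only [h, htoNat_fin, hrk_fin, hext_fin, hrange']
      obtain ⟨⟨ha, hb⟩, -⟩ := hpq i hi
      exact ⟨by omega, by simpa only [Fin.ext_iff, ne_eq] using hb⟩
  · intro m hm
    rw [hD3 m hm, hD1 m hm]
    rcases htT m with h | ⟨i, hi, h⟩
    · refine ⟨?_, .inl ⟨?_, htoNat_n _ _ _ m hm h⟩⟩
      · simp [h, hrk]; omega
      · simp [h, hext]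
    · simp only [h, htoNat_fin, hrk_fin, hext_fin, hrange']
      obtain ⟨-, ha, hb⟩ := hpq i hi
      exact ⟨by omega, by simpa only [Fin.ext_iff, ne_eq] using hb⟩

end ScalingInstance

/-! ### Enumeration of digit sequences -/

/-- The digits of `v` in base `b`. -/
def baseDigits (b v j : ℕ) : ℕ := v / b ^ j % b

lemma exists_baseDigits_eq {b L : ℕ} {D : ℕ → ℕ} (hD : ∀ j, D j < b) (hL : ∀ j, L ≤ j → D j = 0) :
    ∃ v < b ^ L, baseDigits b v = D := by
  set f : Fin L → Fin b := fun j => ⟨D j, hD j⟩ with hf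
  refine ⟨finFunctionFinEquiv f, (finFunctionFinEquiv f).2, funext fun j => ?_⟩
  by_cases hj : j < L
  · have h := finFunctionFinEquiv_symm_apply_val (finFunctionFinEquiv f) ⟨j, hj⟩
    rw [Equiv.symm_apply_apply] at h
    exact h.symm
  · have hb : 0 < b := (Nat.zero_le _).trans_lt (hD 0)
    rw [baseDigits, hL j (by omega), Nat.div_eq_of_lt, Nat.zero_mod]
    exact (finFunctionFinEquiv f).2.trans_le (Nat.pow_le_pow_right hb (by omega))

/-- The candidates given by all digit sequences are sufficient. -/
theorem ScalingInstance.yes_iff (C : GraphClass) (I : ScalingInstance) : C.scaling.Yes I ↔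
    ∃ v < (I.n + 2) ^ (I.k + I.k + I.k), I.Valid C (baseDigits (I.n + 2) v) := by
  constructor
  · rintro ⟨T, r, -, hcard, hT, hT', hC⟩
    have hsep : ∀ᶠ δ : ℝ in 𝓝[>] 0, ∀ i j, i ≠ j → ¬ (diskGraph I.pt r).Adj i j →
        r i + r j ≤ I.ptDist i j - δ := by
      simp only [eventually_all]
      intro i j hij hadj
      have : 0 < I.ptDist i j - (r i + r j) := by
        rw [I.ptDist_eq, sub_pos]
        by_contra! h
        exact hadj ⟨hij, h⟩
      filter_upwards [Ioo_mem_nhdsGT this] with δ hδ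
      linarith [hδ.2]
    have hiff : ∀ᶠ δ : ℝ in 𝓝[>] 0, ∀ v : Fin ((I.n + 2) ^ (I.k + I.k + I.k)),
        (I.ValidAt C (baseDigits (I.n + 2) v) δ ↔ I.Valid C (baseDigits (I.n + 2) v)) := by
      simp only [eventually_all]
      exact fun v => I.eventually_validAt_iff C _
    -- The digits obtained below depend on `δ`, so `δ` must be fixed first, good for all of the
    -- finitely many digit sequences at once.
    obtain ⟨δ, ⟨h1, h2⟩, hδ⟩ := ((hsep.and hiff).and self_mem_nhdsWithin).exists
    obtain ⟨D, hD, hL, hval⟩ := I.exists_validAt hcard hT hT' hC hδ h1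
    obtain ⟨v, hv, rfl⟩ := exists_baseDigits_eq hD hL
    exact ⟨v, hv, (h2 ⟨v, hv⟩).1 hval⟩
  · rintro ⟨v, -, hv⟩
    obtain ⟨δ, hδ⟩ := (I.eventually_validAt_iff C (baseDigits (I.n + 2) v)).exists
    exact I.yes_of_validAt (hδ.2 hv)

/-! ### Incrementing a digit sequence -/

lemma baseDigits_succ_index (b v j : ℕ) : baseDigits b v (j + 1) = baseDigits b (v / b) j := by
  rw [baseDigits, baseDigits, pow_succ', Nat.div_div_eq_div_mul]

/-- Addition of one with carry up to position `c`. The base `n + 2` satisfies `2 ≤ b` even for `n =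
0`. -/
lemma baseDigits_succ {b c : ℕ} (hb : 2 ≤ b) : ∀ {v : ℕ}, (∀ j < c, baseDigits b v j = b - 1) →
    baseDigits b v c < b - 1 → baseDigits b (v + 1) =
      fun j => if j < c then 0 else if j = c then baseDigits b v c + 1 else baseDigits b v j := by
  induction c with
  | zero =>
    intro v _ h
    have h0 : v % b < b - 1 := by simpa [baseDigits] using h
    have hdiv : (v + 1) / b = v / b := by
      rw [Nat.succ_div, if_neg, add_zero]
      intro hd
      have := Nat.mod_eq_zero_of_dvd hd
      rw [Nat.add_mod, Nat.mod_eq_of_lt (show 1 < b by omega), Nat.mod_eq_of_lt (by omega)] at this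
      omega
    funext j
    rcases j with _ | j
    · simp only [baseDigits, pow_zero, Nat.div_one, lt_irrefl, if_false, if_true]
      rw [Nat.add_mod, Nat.mod_eq_of_lt (show 1 < b by omega), Nat.mod_eq_of_lt (by omega)]
    · simp [baseDigits_succ_index, hdiv]
  | succ c ih =>
    intro v h1 h2
    have h0 : v % b = b - 1 := by simpa [baseDigits] using h1 0 (by omega)
    have hv : v + 1 = b * (v / b + 1) := by
      have := Nat.div_add_mod v b
      rw [Nat.mul_add]; omega
    have hdiv : (v + 1) / b = v / b + 1 := by
      rw [hv, Nat.mul_div_cancel_left _ (by omega)]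
    funext j
    rcases j with _ | j
    · simp [baseDigits, hv]
    · rw [baseDigits_succ_index, hdiv, ih (v := v / b)
        (fun j hj => by rw [← baseDigits_succ_index]; exact h1 _ (by omega))
        (by rwa [← baseDigits_succ_index])]
      simp [baseDigits_succ_index]

namespace RealRAM

/-! ### The program for the scaling problem -/

namespace Scaling

/-- Number of points. -/
abbrev nE : NExp := .read 0 (.const 0)
/-- Budget. -/
abbrev kE : NExp := .read 0 (.const 1)
/-- Current vertex. -/
abbrev tE : NExp := .read 1 (.var 5)
/-- Partner of the current vertex for its upper potential. -/
abbrev pE : NExp := .read 1 (.add (.var 5) kE)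
/-- Partner of the current vertex for its lower potential. -/
abbrev qE : NExp := .read 1 (.add (.add (.var 5) kE) kE)
abbrev zeroE : RExp := .ofNat (.const 0)
abbrev oneE : RExp := .ofNat (.const 1)
abbrev loE : RExp := .read 0 (.const 0)
abbrev hiE : RExp := .read 0 (.const 1)

abbrev diffE (a : ℕ) (i j : NExp) : RExp := .sub (.read a i) (.read a j)

abbrev distE (i j : NExp) : RExp :=
  .sqrt (.add (.mul (diffE 1 i j) (diffE 1 i j)) (.mul (diffE 2 i j) (diffE 2 i j)))

abbrev eqTest (i j : NExp) : Test := .and (.not (.natLt i j)) (.not (.natLt j i))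

abbrev lexTest (a b : RExp) : Test :=
  .and (.not (.realLt a zeroE)) (.not (.and (.not (.realLt zeroE a)) (.realLt b zeroE)))

/-- Difference of the upper and the lower potential. -/
abbrev gapE (a b : ℕ) (i : NExp) : RExp := .sub (.read a i) (.read b i)

abbrev boundTest : Test :=
  .and (lexTest (.sub (gapE 3 5 tE) (.add loE loE)) (gapE 4 6 tE))
    (lexTest (.sub (.add hiE hiE) (gapE 3 5 tE)) (gapE 6 4 tE))

abbrev adjTest : Test :=
  .and (.not (eqTest (.var 3) (.var 4)))
    (lexTest (.sub (.add (gapE 3 5 (.var 3)) (gapE 3 5 (.var 4)))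
        (.add (distE (.var 3) (.var 4)) (distE (.var 3) (.var 4))))
      (.add (gapE 4 6 (.var 3)) (gapE 4 6 (.var 4))))

/-- Reset all potentials. -/
def initProg : Prog :=
  forLoop 3 (.add nE (.const 2))
    (.seq (.setReal 3 (.var 3) oneE) (.seq (.setReal 4 (.var 3) zeroE)
      (.seq (.setReal 5 (.var 3) (.sub zeroE oneE)) (.setReal 6 (.var 3) zeroE))))

def stepUpProg : Prog :=
  .ite (eqTest tE pE) (.seq (.setReal 3 tE hiE) (.setReal 4 tE zeroE))
    (.seq (.setReal 3 tE (.add (.read 5 pE) (distE tE pE)))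
      (.setReal 4 tE (.sub (.read 6 pE) oneE)))

def stepDownProg : Prog :=
  .ite (eqTest tE qE) (.seq (.setReal 5 tE (.sub zeroE loE)) (.setReal 6 tE zeroE))
    (.seq (.setReal 5 tE (.sub (.read 3 qE) (distE tE qE))) (.setReal 6 tE (.read 4 qE)))

def sweepProg : Prog := forLoop 5 kE (.seq stepUpProg stepDownProg)

/-- Compute the potentials that belong to the current digits. -/
def roundsProg : Prog := forLoop 6 (.add kE kE) sweepProg

/-- Check the bounds on the radii. -/
def checkProg : Prog :=
  .seq (.setNat 9 (.const 0) (.const 1))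
    (forLoop 5 kE (.ite boundTest .skip (.setNat 9 (.const 0) (.const 0))))

def adjacencyProg : Prog :=
  forLoop 3 nE (forLoop 4 nE (.seq (.ite adjTest (.setNat 13 (.var 7) (.const 1)) .skip)
    (.setNat 7 (.const 0) (.add (.var 7) (.const 1)))))

/-- Write the disk graph into the relocated memory. -/
def graphProg : Prog :=
  .seq (.setNat 12 (.var 10) nE) (.seq (.setNat 7 (.const 0) (.var 10))
    (.seq adjacencyProg (.setNat 11 (.const 0) (.add (.var 7) (.const 1)))))

/-- Record a success and discard the used part of the relocated memory. -/
def collectProg : Prog :=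
  .seq (.ite (.and (.natLt (.const 0) (.var 9)) (.natLt (.const 0) (.read 12 (.var 10))))
    (.setNat 8 (.const 0) (.const 1)) .skip) (.setNat 10 (.const 0) (.var 11))

/-- Proceed to the next sequence of digits. -/
def nextProg : Prog :=
  .seq (.setNat 3 (.const 0) (.const 0))
    (.seq (.loop (.natLt nE (.read 1 (.var 3)))
        (.seq (.setNat 1 (.var 3) (.const 0)) (.setNat 3 (.const 0) (.add (.var 3) (.const 1)))))
      (.setNat 1 (.var 3) (.add (.read 1 (.var 3)) (.const 1))))

/-- The program for the scaling problem, where `p` is a program for the recognition problem. -/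
def mainProg (p : Prog) : Prog :=
  .seq (.loop (.natLt (.read 1 (.add (.add kE kE) kE)) (.const 1))
      (.seq initProg (.seq roundsProg (.seq checkProg (.seq graphProg
        (.seq p.reloc (.seq collectProg nextProg)))))))
    (.setNat 0 (.const 0) (.var 8))

/-! ### Correctness of the phases -/

/-- The memory contains the instance `I`. -/
structure HasInput (I : ScalingInstance) (s : Store) : Prop where
  nat : s.nat 0 = (scalingStore I).nat 0
  real0 : s.real 0 = (scalingStore I).real 0
  real1 : s.real 1 = (scalingStore I).real 1
  real2 : s.real 2 = (scalingStore I).real 2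

namespace HasInput

variable {I : ScalingInstance} {s : Store}

lemma n (h : HasInput I s) : s.nat 0 0 = I.n := by rw [h.nat]; rfl
lemma k (h : HasInput I s) : s.nat 0 1 = I.k := by rw [h.nat]; rfl
lemma lo (h : HasInput I s) : s.real 0 0 = I.rmin := by rw [h.real0]; rfl
lemma hi (h : HasInput I s) : s.real 0 1 = I.rmax := by rw [h.real0]; rfl

end HasInput

/-- The memory between two recognition phases: instance, digits, number of successes, and the first
free relocated index. -/
structure Context (I : ScalingInstance) (D : ℕ → ℕ) (F : ℕ → ℕ) (β : ℕ) (s : Store) : Prop where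
  input : HasInput I s
  digits : s.nat 1 = D
  found : s.nat 8 = F
  base : s.nat 10 0 = β
  top : s.nat 11 0 = β
  zero : s.ZeroFrom β

/-- The program only modifies the working memory. -/
structure Local (p : Prog) : Prop where
  nat : ∀ a, p.KeepsNat (a + 10)
  nat0 : p.KeepsNat 0
  nat1 : p.KeepsNat 1
  nat8 : p.KeepsNat 8
  real : ∀ a, p.KeepsReal (a + 10)
  real0 : p.KeepsReal 0
  real1 : p.KeepsReal 1
  real2 : p.KeepsReal 2

variable {I : ScalingInstance} {D F : ℕ → ℕ} {β : ℕ} {s : Store}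

/-- Reduces the preservation of the context to a syntactic check, so that each phase only has to be
verified for its own output. -/
lemma Local.runs {p : Prog} (hp : Local p) (hs : Context I D F β s) {T : ℕ} {Q : Store → Prop}
    (h : Runs p s T Q) : Runs p s T (fun s' => Context I D F β s' ∧ Q s') := by
  refine h.frame.mono le_rfl ?_
  rintro s' ⟨hq, hn, hr⟩
  refine ⟨⟨⟨?_, ?_, ?_, ?_⟩, ?_, ?_, ?_, ?_, fun a i hi => ?_⟩, hq⟩
  · rw [hn 0 hp.nat0, hs.input.nat]
  · rw [hr 0 hp.real0, hs.input.real0]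
  · rw [hr 1 hp.real1, hs.input.real1]
  · rw [hr 2 hp.real2, hs.input.real2]
  · rw [hn 1 hp.nat1, hs.digits]
  · rw [hn 8 hp.nat8, hs.found]
  · rw [hn 10 (hp.nat 0), hs.base]
  · rw [hn 11 (hp.nat 1), hs.top]
  · rw [hn (a + 12) (hp.nat (a + 2)), hr (a + 12) (hp.real (a + 2))]
    exact hs.zero a i hi

/-- Changing a counter does not affect the context. -/
lemma Context.writeNat (hs : Context I D F β s) {a : ℕ} (i v : ℕ) (ha : 1 < a ∧ a < 8 ∨ a = 9) :
    Context I D F β (s.writeNat a i v) where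
  input := ⟨by rw [Store.nat_writeNat_ne _ _ _ (by omega), hs.input.nat], hs.input.real0,
    hs.input.real1, hs.input.real2⟩
  digits := by rw [Store.nat_writeNat_ne _ _ _ (by omega), hs.digits]
  found := by rw [Store.nat_writeNat_ne _ _ _ (by omega), hs.found]
  base := by rw [Store.nat_writeNat_ne _ _ _ (by omega), hs.base]
  top := by rw [Store.nat_writeNat_ne _ _ _ (by omega), hs.top]
  zero b j hj := by
    rw [Store.nat_writeNat_ne _ _ _ (by omega), Store.real_writeNat]; exact hs.zero b j hj

/-- The memory contains the potentials `V` of the vertices below `N`. -/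
def HasPotentials (N : ℕ) (V : Potentials) (s : Store) : Prop :=
  ∀ i < N, s.real 3 i = V.pa i ∧ s.real 4 i = V.pb i ∧ s.real 5 i = V.qa i ∧ s.real 6 i = V.qb i

lemma runs_init (hs : Context I D F β s) : Runs initProg s (100 * (I.n + 2))
    (fun s' => Context I D F β s' ∧ HasPotentials (I.n + 2) Potentials.unit s') := by
  refine (runs_forLoop (B := 40) (I.n + 2)
    (fun m s => Context I D F β s ∧ HasPotentials m Potentials.unit s) ?_ ?_ ?_
    ⟨hs, fun i hi => absurd hi (Nat.not_lt_zero i)⟩).mono ?_ fun _ h => h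
  · rintro m - s ⟨h, -⟩
    simp [NExp.eval, h.input.n]
  · rintro m - s v ⟨h, h'⟩
    exact ⟨h.writeNat _ _ (by omega), h'⟩
  · rintro m - s ⟨h, h'⟩ hm
    have key : Runs (.seq (.setReal 3 (.var 3) oneE) (.seq (.setReal 4 (.var 3) zeroE)
        (.seq (.setReal 5 (.var 3) (.sub zeroE oneE)) (.setReal 6 (.var 3) zeroE)))) s 40
        (fun s' => s'.nat 3 0 = m ∧ HasPotentials (m + 1) Potentials.unit s') := by
      refine ⟨_, _, .seq (.setReal _ _ _ _) (.seq (.setReal _ _ _ _) (.seq (.setReal _ _ _ _)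
        (.setReal _ _ _ _))), by decide, ?_⟩
      simp only [NExp.eval, Store.nat_writeReal, hm, RExp.eval, true_and]
      intro i hi
      rcases Nat.lt_succ_iff_lt_or_eq.1 hi with hi | rfl
      · have := h' i hi
        simpa [hi.ne] using this
      · simp [Potentials.unit]
    refine ((show Local _ from ?_).runs h key).mono le_rfl fun s' h => ⟨h.2.1, h.1, h.2.2⟩
    constructor <;> simp [Prog.KeepsNat, Prog.KeepsReal]
  · simp only [NExp.cost]; omega

lemma holds_eqTest (i j : NExp) : (eqTest i j).Holds s ↔ i.eval s = j.eval s := by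
  simp only [Test.Holds]; omega

lemma holds_lexTest (a b : RExp) : (lexTest a b).Holds s ↔ LexNonneg (a.eval s) (b.eval s) := by
  simp [Test.Holds, LexNonneg, RExp.eval, NExp.eval]

lemma eval_distE (hs : HasInput I s) (i j : NExp) :
    (distE i j).eval s = I.ptDist (i.eval s) (j.eval s) := by
  simp [RExp.eval, hs.real1, hs.real2, ScalingInstance.ptDist]

lemma runs_stepUp {V : Potentials} {m : ℕ} (hs : Context I D F β s) (hD : ∀ j, D j < I.n + 2)
    (hm : s.nat 5 0 = m) (hV : HasPotentials (I.n + 2) V s) :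
    Runs stepUpProg s 200 (fun s' => HasPotentials (I.n + 2)
      (V.stepUp I.ptDist I.rmax (D m) (D (m + I.k))) s') := by
  have ht : tE.eval s = D m := by simp [NExp.eval, hm, hs.digits]
  have hp : pE.eval s = D (m + I.k) := by simp [NExp.eval, hm, hs.digits, hs.input.k]
  refine (runs_ite (T := 170) (fun h => ?_) fun h => ?_).mono (by decide) fun _ h => h
  · rw [holds_eqTest, ht, hp] at h
    refine ⟨_, _, .seq (.setReal _ _ _ _) (.setReal _ _ _ _), by decide, fun i hi => ?_⟩
    have ht' : ∀ v, tE.eval (s.writeReal 3 (D m) v) = D m := fun v => ht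
    rw [ht, ht', Potentials.stepUp, if_pos h]
    obtain ⟨h1, h2, h3, h4⟩ := hV i hi
    by_cases hi : i = D m
    · subst hi; simp [RExp.eval, NExp.eval, hs.input.hi, h3, h4]
    · simp [hi, h1, h2, h3, h4]
  · rw [holds_eqTest, ht, hp] at h
    refine ⟨_, _, .seq (.setReal _ _ _ _) (.setReal _ _ _ _), by decide, fun i hi => ?_⟩
    have ht' : ∀ v, tE.eval (s.writeReal 3 (D m) v) = D m := fun v => ht
    rw [ht, ht', Potentials.stepUp, if_neg h]
    obtain ⟨h1, h2, h3, h4⟩ := hV i hi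
    obtain ⟨-, -, h3', h4'⟩ := hV _ (hD (m + I.k))
    have e1 : (RExp.add (.read 5 pE) (distE tE pE)).eval s =
        V.qa (D (m + I.k)) + I.ptDist (D m) (D (m + I.k)) := by
      rw [RExp.eval, eval_distE hs.input, ht, hp, RExp.eval, hp, h3']
    have e2 : ∀ v, (RExp.sub (.read 6 pE) oneE).eval (s.writeReal 3 (D m) v) =
        V.qb (D (m + I.k)) - 1 := by
      intro v
      have hp' : pE.eval (s.writeReal 3 (D m) v) = D (m + I.k) := hp
      simp only [RExp.eval, hp', Store.real_writeReal_ne _ _ _ (show 6 ≠ 3 by decide), h4']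
      simp [NExp.eval]
    rw [e1, e2]
    by_cases hi : i = D m
    · subst hi; simp [h3, h4]
    · simp [hi, h1, h2, h3, h4]

lemma runs_stepDown {V : Potentials} {m : ℕ} (hs : Context I D F β s) (hD : ∀ j, D j < I.n + 2)
    (hm : s.nat 5 0 = m) (hV : HasPotentials (I.n + 2) V s) :
    Runs stepDownProg s 200 (fun s' => HasPotentials (I.n + 2)
      (V.stepDown I.ptDist I.rmin (D m) (D (m + I.k + I.k))) s') := by
  have ht : tE.eval s = D m := by simp [NExp.eval, hm, hs.digits]
  have hq : qE.eval s = D (m + I.k + I.k) := by simp [NExp.eval, hm, hs.digits, hs.input.k]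
  refine (runs_ite (T := 170) (fun h => ?_) fun h => ?_).mono (by decide) fun _ h => h
  · rw [holds_eqTest, ht, hq] at h
    refine ⟨_, _, .seq (.setReal _ _ _ _) (.setReal _ _ _ _), by decide, fun i hi => ?_⟩
    have ht' : ∀ v, tE.eval (s.writeReal 5 (D m) v) = D m := fun v => ht
    rw [ht, ht', Potentials.stepDown, if_pos h]
    obtain ⟨h1, h2, h3, h4⟩ := hV i hi
    by_cases hi : i = D m
    · subst hi; simp [RExp.eval, NExp.eval, hs.input.lo, h1, h2]
    · simp [hi, h1, h2, h3, h4]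
  · rw [holds_eqTest, ht, hq] at h
    refine ⟨_, _, .seq (.setReal _ _ _ _) (.setReal _ _ _ _), by decide, fun i hi => ?_⟩
    have ht' : ∀ v, tE.eval (s.writeReal 5 (D m) v) = D m := fun v => ht
    rw [ht, ht', Potentials.stepDown, if_neg h]
    obtain ⟨h1, h2, h3, h4⟩ := hV i hi
    obtain ⟨h1', h2', -, -⟩ := hV _ (hD (m + I.k + I.k))
    have e1 : (RExp.sub (.read 3 qE) (distE tE qE)).eval s =
        V.pa (D (m + I.k + I.k)) - I.ptDist (D m) (D (m + I.k + I.k)) := by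
      rw [RExp.eval, eval_distE hs.input, ht, hq, RExp.eval, hq, h1']
    have e2 : ∀ v, (RExp.read 4 qE).eval (s.writeReal 5 (D m) v) =
        V.pb (D (m + I.k + I.k)) := by
      intro v
      have hq' : qE.eval (s.writeReal 5 (D m) v) = D (m + I.k + I.k) := hq
      rw [RExp.eval, hq', Store.real_writeReal_ne _ _ _ (by decide), h2']
    rw [e1, e2]
    by_cases hi : i = D m
    · subst hi; simp [h1, h2]
    · simp [hi, h1, h2, h3, h4]

lemma local_stepUp : Local stepUpProg := by
  constructor <;> simp [stepUpProg, Prog.KeepsNat, Prog.KeepsReal]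

lemma local_stepDown : Local stepDownProg := by
  constructor <;> simp [stepDownProg, Prog.KeepsNat, Prog.KeepsReal]

lemma runs_sweep {V : Potentials} (hs : Context I D F β s) (hD : ∀ j, D j < I.n + 2)
    (hV : HasPotentials (I.n + 2) V s) :
    Runs sweepProg s (500 * (I.k + 1)) (fun s' => Context I D F β s' ∧ HasPotentials (I.n + 2)
      (Potentials.sweep I.ptDist I.rmin I.rmax D (fun m => D (m + I.k))
        (fun m => D (m + I.k + I.k)) I.k V) s') := by
  refine (runs_forLoop (B := 400) I.k (fun m s => Context I D F β s ∧ HasPotentials (I.n + 2)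
      (Potentials.sweep I.ptDist I.rmin I.rmax D (fun m => D (m + I.k))
        (fun m => D (m + I.k + I.k)) m V) s) ?_ ?_ ?_ ⟨hs, hV⟩).mono ?_ fun _ h => h
  · rintro m - s ⟨h, -⟩
    simp [NExp.eval, h.input.k]
  · rintro m - s v ⟨h, h'⟩
    exact ⟨h.writeNat _ _ (by omega), h'⟩
  · rintro m - s ⟨h, h'⟩ hm
    refine Runs.seq (T₁ := 200) (T₂ := 200)
      (local_stepUp.runs h (runs_stepUp h hD hm h').frame) ?_
    rintro s' ⟨h1, h2, h3, -⟩
    have hm' : s'.nat 5 0 = m := by rw [h3 5 (by simp [stepUpProg, Prog.KeepsNat]), hm]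
    refine (local_stepDown.runs h1 (runs_stepDown h1 hD hm' h2).frame).mono le_rfl ?_
    rintro s'' ⟨h4, h5, h6, -⟩
    exact ⟨by rw [h6 5 (by simp [stepDownProg, Prog.KeepsNat]), hm'], h4, h5⟩
  · simp only [NExp.cost]; omega

lemma runs_rounds (hs : Context I D F β s) (hD : ∀ j, D j < I.n + 2)
    (hV : HasPotentials (I.n + 2) Potentials.unit s) :
    Runs roundsProg s (1200 * (I.k + 1) ^ 2) (fun s' => Context I D F β s' ∧
      HasPotentials (I.n + 2) (I.candidate D) s') := by
  refine (runs_forLoop (B := 500 * (I.k + 1)) (I.k + I.k) (fun r s => Context I D F β s ∧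
      HasPotentials (I.n + 2)
      ((Potentials.sweep I.ptDist I.rmin I.rmax D (fun m => D (m + I.k))
        (fun m => D (m + I.k + I.k)) I.k)^[r] Potentials.unit) s) ?_ ?_ ?_ ⟨hs, hV⟩).mono ?_
    fun _ h => h
  · rintro m - s ⟨h, -⟩
    simp [NExp.eval, h.input.k]
  · rintro m - s v ⟨h, h'⟩
    exact ⟨h.writeNat _ _ (by omega), h'⟩
  · rintro m - s ⟨h, h'⟩ hm
    refine (runs_sweep h hD h').frame.mono le_rfl ?_
    rintro s' ⟨⟨h1, h2⟩, h3, -⟩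
    refine ⟨?_, h1, by rwa [Function.iterate_succ_apply']⟩
    rw [h3 6 (by simp [sweepProg, forLoop, stepUpProg, stepDownProg, Prog.KeepsNat]), hm]
  · simp only [NExp.cost]; nlinarith

lemma holds_boundTest {V : Potentials} {m : ℕ} (hs : Context I D F β s) (hD : ∀ j, D j < I.n + 2)
    (hm : s.nat 5 0 = m) (hV : HasPotentials (I.n + 2) V s) :
    boundTest.Holds s ↔ I.LexBounded V (D m) := by
  have ht : tE.eval s = D m := by simp [NExp.eval, hm, hs.digits]
  obtain ⟨h1, h2, h3, h4⟩ := hV _ (hD m)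
  rw [Test.Holds, holds_lexTest, holds_lexTest]
  simp only [RExp.eval, ht, h1, h2, h3, h4]
  simp only [NExp.eval, hs.input.lo, hs.input.hi]
  rfl

lemma runs_check {V : Potentials} (hs : Context I D F β s) (hD : ∀ j, D j < I.n + 2)
    (hV : HasPotentials (I.n + 2) V s) :
    Runs checkProg s (300 * (I.k + 1)) (fun s' => Context I D F β s' ∧
      HasPotentials (I.n + 2) V s' ∧ (s'.nat 9 0 ≠ 0 ↔ ∀ m < I.k, I.LexBounded V (D m))) := by
  refine Runs.mono (T := 3 + (I.k * (2 + 200 + 10) + 2 + 10)) ?_ (by omega) fun _ h => h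
  refine Runs.seq (R := fun s => Context I D F β s ∧ HasPotentials (I.n + 2) V s ∧ s.nat 9 0 = 1)
    (runs_setNat (by decide) ⟨hs.writeNat _ _ (by omega), hV, by simp [NExp.eval]⟩) ?_
  rintro s ⟨hs, hV, h9⟩
  refine runs_forLoop (B := 200) I.k (fun m s => Context I D F β s ∧ HasPotentials (I.n + 2) V s ∧
    (s.nat 9 0 ≠ 0 ↔ ∀ m' < m, I.LexBounded V (D m'))) ?_ ?_ ?_ ⟨hs, hV, by simp [h9]⟩
  · rintro m - s ⟨h, -⟩
    simp [NExp.eval, h.input.k]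
  · rintro m - s v ⟨h, h', h''⟩
    exact ⟨h.writeNat _ _ (by omega), h', by simpa using h''⟩
  · rintro m - s ⟨h, h', h''⟩ hm
    have htest := holds_boundTest h hD hm h'
    have hsucc : (∀ m' < m + 1, I.LexBounded V (D m')) ↔
        (∀ m' < m, I.LexBounded V (D m')) ∧ I.LexBounded V (D m) := Nat.forall_lt_succ_right
    refine (runs_ite (T := 3) (fun hb => ?_) fun hb => ?_).mono (by decide) fun _ h => h
    · refine runs_skip (by decide) ⟨hm, h, h', ?_⟩
      rw [h'', hsucc, ← htest, and_iff_left hb]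
    · refine runs_setNat (by decide) ⟨by simpa using hm, h.writeNat _ _ (by omega), h', ?_⟩
      rw [hsucc, ← htest]
      simp only [NExp.eval, Store.nat_writeNat_same, Function.update_self, ne_eq,
        not_true_eq_false, false_iff]
      exact fun h => hb h.2

/-! ### Writing the disk graph -/

lemma holds_adjTest {V : Potentials} {i j : ℕ} (hs : HasInput I s) (hV : HasPotentials (I.n + 2) V s)
    (hi : i < I.n) (hj : j < I.n) (hi' : s.nat 3 0 = i) (hj' : s.nat 4 0 = j) :
    adjTest.Holds s ↔ I.LexAdj V i j := by
  have e1 : (NExp.var 3).eval s = i := hi'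
  have e2 : (NExp.var 4).eval s = j := hj'
  obtain ⟨h1, h2, h3, h4⟩ := hV i (by omega)
  obtain ⟨g1, g2, g3, g4⟩ := hV j (by omega)
  have e3 : (distE (.var 3) (.var 4)).eval s = I.ptDist i j := by rw [eval_distE hs, e1, e2]
  have e4 : (RExp.add (distE (.var 3) (.var 4)) (distE (.var 3) (.var 4))).eval s =
      I.ptDist i j + I.ptDist i j := by rw [RExp.eval, e3]
  rw [Test.Holds, holds_lexTest, RExp.eval, RExp.eval, RExp.eval, e4, Test.Holds, holds_eqTest]
  simp only [RExp.eval, e1, e2, h1, h2, h3, h4, g1, g2, g3, g4]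
  rfl

/-- Division by `n` recovers `i` and `j` from the cell index, so no other pair of vertices is stored
in that cell. -/
lemma graphStore_adj {n : ℕ} (G : SimpleGraph (Fin n)) (i j : Fin n) :
    ((graphStore ⟨n, G⟩).nat 1 (i * n + j) = 1 ∧ G.Adj i j) ∨
      ((graphStore ⟨n, G⟩).nat 1 (i * n + j) = 0 ∧ ¬ G.Adj i j) := by
  classical
  have huniq : ∀ i' j' : Fin n, (i : ℕ) * n + j = i' * n + j' → i' = i ∧ j' = j := by
    intro i' j' h
    have hn : 0 < n := i.pos
    have h1 : (i : ℕ) = i' := by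
      have := congrArg (· / n) h
      simpa [Nat.add_div_of_dvd_right (Dvd.intro_left _ rfl), Nat.mul_div_cancel _ hn,
        Nat.div_eq_of_lt j.2, Nat.div_eq_of_lt j'.2] using this
    rw [h1] at h
    exact ⟨Fin.ext h1.symm, Fin.ext (by omega)⟩
  by_cases hG : G.Adj i j
  · exact .inl ⟨if_pos ⟨i, j, rfl, hG⟩, hG⟩
  · refine .inr ⟨if_neg ?_, hG⟩
    rintro ⟨i', j', h, h'⟩
    obtain ⟨rfl, rfl⟩ := huniq i' j' h
    exact hG h'

lemma graphStore_of_le {n m : ℕ} (G : SimpleGraph (Fin n)) (hm : n * n ≤ m) :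
    (graphStore ⟨n, G⟩).nat 1 m = 0 := by
  classical
  refine if_neg ?_
  rintro ⟨i, j, rfl, -⟩
  have h1 := i.2
  have h2 := j.2
  have : (i : ℕ) * n + n ≤ n * n := by
    calc (i : ℕ) * n + n = (i + 1) * n := by ring
      _ ≤ n * n := Nat.mul_le_mul_right _ h1
  dsimp only at *
  omega

/-- The machine cannot multiply natural numbers, so the address `β + i * n + j` is kept as a running
pointer in array `7`. Only ones are written; zeros are already there. -/
lemma runs_adjacency {V : Potentials} {s₀ : Store} (hs : HasInput I s₀)
    (hV : HasPotentials (I.n + 2) V s₀) (h7 : s₀.nat 7 0 = β) (h13 : ∀ m, s₀.nat 13 (β + m) = 0) :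
    Runs adjacencyProg s₀ (500 * (I.n + 1) ^ 2) (fun s' => s'.nat 7 0 = β + I.n * I.n ∧
      ∀ m, s'.nat 13 (β + m) = (graphStore ⟨I.n, I.lexGraph V⟩).nat 1 m) := by
  set g : ℕ → ℕ := (graphStore ⟨I.n, I.lexGraph V⟩).nat 1 with hg
  set Inv : ℕ → Store → Prop := fun c s => s.nat 0 = s₀.nat 0 ∧ s.real = s₀.real ∧
    s.nat 7 0 = β + c ∧ ∀ m, s.nat 13 (β + m) = if m < c then g m else 0 with hInv
  have hw : ∀ c s a v, a = 3 ∨ a = 4 → Inv c s → Inv c (s.writeNat a 0 v) := by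
    rintro c s a v ha ⟨h1, h2, h3, h4⟩
    refine ⟨?_, h2, ?_, ?_⟩ <;> rcases ha with rfl | rfl <;> simpa
  have hn : ∀ c s, Inv c s → nE.eval s = I.n := by
    rintro c s ⟨h1, -⟩
    simp only [NExp.eval, h1, hs.n]
  refine Runs.mono (T := I.n * (2 + 400 * (I.n + 1) + 10) + 2 + 10) (Q := Inv (I.n * I.n)) ?_
    (by nlinarith) ?_
  · refine runs_forLoop (B := 400 * (I.n + 1)) I.n (fun i s => Inv (i * I.n) s)
      (fun _ _ s h => hn _ s h) (fun _ _ s v h => hw _ s 3 v (.inl rfl) h) ?_ ?_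
    · intro i hi s h h3
      refine (runs_forLoop (B := 350) I.n (fun j s => s.nat 3 0 = i ∧ Inv (i * I.n + j) s)
        (fun _ _ s h => hn _ s h.2) (fun _ _ s v h => ⟨by simpa using h.1,
          hw _ s 4 v (.inr rfl) h.2⟩) ?_ ⟨h3, h⟩).mono ?_ ?_
      · rintro j hj s ⟨h3, h⟩ h4
        have hnext := h
        obtain ⟨i1, i2, i3, i4⟩ := h
        have htest : adjTest.Holds s ↔ I.LexAdj V i j := holds_adjTest
          ⟨i1.trans hs.nat, by rw [i2, hs.real0], by rw [i2, hs.real1], by rw [i2, hs.real2]⟩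
          (by unfold HasPotentials; rwa [i2]) hi hj h3 h4
        have hgij := graphStore_adj (I.lexGraph V) ⟨i, hi⟩ ⟨j, hj⟩
        have hlast : ∀ m, (if m < i * I.n + (j + 1) then g m else 0) =
            if m = i * I.n + j then g m else if m < i * I.n + j then g m else 0 := by
          intro m
          split_ifs <;> first | rfl | omega
        refine Runs.mono (T := 300 + 6) ?_ (by decide) fun _ h => h
        refine Runs.seq (R := fun s => s.nat 3 0 = i ∧ s.nat 4 0 = j ∧ s.nat 0 = s₀.nat 0 ∧
          s.real = s₀.real ∧ s.nat 7 0 = β + (i * I.n + j) ∧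
          ∀ m, s.nat 13 (β + m) = if m < i * I.n + (j + 1) then g m else 0) ?_ ?_
        · refine (runs_ite (T := 5) (fun hb => ?_) fun hb => ?_).mono (by decide) fun _ h => h
          · refine runs_setNat (by decide) ?_
            simp only [NExp.eval, i3]
            refine ⟨by simpa using h3, by simpa using h4, by simpa using i1, i2,
              by simpa using i3, fun m => ?_⟩
            have hg1 : g (i * I.n + j) = 1 := by
              rcases hgij with h | h
              · exact h.1
              · exact absurd (htest.1 hb) h.2
            rw [hlast, Store.nat_writeNat_same]
            by_cases hm : m = i * I.n + j
            · subst hm; simp [hg1]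
            · rw [Function.update_of_ne (by omega), if_neg hm]; exact i4 m
          · refine runs_skip (by decide) ⟨h3, h4, i1, i2, i3, fun m => ?_⟩
            have hg0 : g (i * I.n + j) = 0 := by
              rcases hgij with h | h
              · exact absurd (htest.2 h.2) hb
              · exact h.1
            rw [hlast]
            by_cases hm : m = i * I.n + j
            · subst hm; simp [hg0, i4]
            · rw [if_neg hm]; exact i4 m
        · rintro s ⟨j1, j2, j3, j4, j5, j6⟩
          refine runs_setNat (by decide) ?_
          simp only [NExp.eval, j5]
          refine ⟨by simpa using j2, by simpa using j1, by simpa using j3, j4, ?_, by simpa using j6⟩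
          simp [add_assoc]
      · simp only [NExp.cost]; omega
      · rintro s ⟨h1, h2⟩
        exact ⟨h1, by rwa [Nat.succ_mul]⟩
    · exact ⟨rfl, rfl, by simpa using h7, fun m => by simp [h13]⟩
  · rintro s ⟨-, -, h1, h2⟩
    refine ⟨h1, fun m => ?_⟩
    rw [h2]
    split_ifs with hm
    · rfl
    · exact (graphStore_of_le _ (by omega)).symm

/-- After the preparation of the recognition phase. -/
lemma runs_graph {V : Potentials} (hs : Context I D F β s) (hV : HasPotentials (I.n + 2) V s) :
    Runs graphProg s (600 * (I.n + 1) ^ 2) (fun s' =>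
      Relocated (graphStore ⟨I.n, I.lexGraph V⟩) s') := by
  have hpos : 1 ≤ (I.n + 1) ^ 2 := Nat.one_le_pow _ _ (by omega)
  refine Runs.mono (T := 6 + (6 + (500 * (I.n + 1) ^ 2 + 6))) ?_ (by omega) fun _ h => h
  refine Runs.seq (R := fun u => u = s.writeNat 12 β I.n)
    (runs_setNat (by decide) (by simp [NExp.eval, hs.base, hs.input.n])) ?_
  rintro u rfl
  refine Runs.seq (R := fun u => u = (s.writeNat 12 β I.n).writeNat 7 0 β)
    (runs_setNat (by decide) (by simp [NExp.eval, hs.base])) ?_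
  rintro u rfl
  refine Runs.seq (runs_adjacency (s₀ := (s.writeNat 12 β I.n).writeNat 7 0 β) (I := I) (V := V)
    (β := β) ?_ hV (by simp) fun m => ?_).frame ?_
  · exact ⟨by simpa using hs.input.nat, hs.input.real0, hs.input.real1, hs.input.real2⟩
  · simpa using (hs.zero 1 (β + m) (by omega)).1
  rintro u ⟨⟨h7, h13⟩, hn, hr⟩
  have hreal : ∀ a, u.real a = s.real a := fun a => by
    rw [hr a (by simp [adjacencyProg, forLoop, Prog.KeepsReal])]; rfl
  have h10 : u.nat 10 0 = β := by
    rw [hn 10 (by simp [adjacencyProg, forLoop, Prog.KeepsNat])]; simpa using hs.base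
  have h12 : u.nat 12 = Function.update (s.nat 12) β I.n := by
    rw [hn 12 (by simp [adjacencyProg, forLoop, Prog.KeepsNat])]; simp
  have hother : ∀ a, u.nat (a + 14) = s.nat (a + 14) := fun a => by
    rw [hn (a + 14) (by simp [adjacencyProg, forLoop, Prog.KeepsNat])]; simp
  refine runs_setNat (by decide) ?_
  simp only [NExp.eval, h7]
  refine ⟨fun a i => ?_, fun a i => ?_, ?_, fun a i hi => ?_⟩
  · rcases a with _ | _ | a
    · simp only [zero_add, Store.nat_writeNat_ne _ _ _ (show 12 ≠ 11 by decide),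
        Store.nat_writeNat_ne _ _ _ (show 10 ≠ 11 by decide), h10, h12]
      rcases i with _ | i
      · simp [graphStore]
      · simpa [graphStore] using (hs.zero 0 (β + (i + 1)) (by omega)).1
    · simpa [h10] using h13 i
    · simpa [h10, hother, graphStore, add_assoc] using (hs.zero (a + 2) (β + i) (by omega)).1
  · simpa [h10, hreal, graphStore] using (hs.zero a (β + i) (by omega)).2
  · simp [h10]; omega
  -- The extra `1` in the new bound keeps it above cell `β`, which holds the number of vertices,
  -- also when `n = 0`.
  · have hi : β + I.n * I.n + 1 ≤ i := by simpa using hi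
    refine ⟨?_, by simpa [hreal] using (hs.zero a i (by omega)).2⟩
    have hz := (hs.zero a i (by omega)).1
    rcases a with _ | _ | a
    · simpa [h12, show i ≠ β by omega] using hz
    · have := h13 (i - β)
      rw [graphStore_of_le _ (by omega), show β + (i - β) = i by omega] at this
      simpa using this
    · simpa [hother, add_assoc] using hz

/-! ### The main loop -/

lemma runs_next {v : ℕ} (hs : HasInput I s) (hD : s.nat 1 = baseDigits (I.n + 2) v)
    (hv : v < (I.n + 2) ^ (I.k + I.k + I.k)) :
    Runs nextProg s (200 * (I.k + 1)) (fun s' => s'.nat 1 = baseDigits (I.n + 2) (v + 1)) := by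
  classical
  -- The carry stops at the first digit that is not maximal; digit `3k` is still `0`, so this
  -- happens within `3k` steps.
  have hex : ∃ c, baseDigits (I.n + 2) v c < I.n + 1 :=
    ⟨I.k + I.k + I.k, by rw [baseDigits, Nat.div_eq_of_lt hv]; simp⟩
  set c := Nat.find hex with hc
  have hcle : c ≤ I.k + I.k + I.k :=
    Nat.find_min' hex (by rw [baseDigits, Nat.div_eq_of_lt hv]; simp)
  have hlow : ∀ j < c, baseDigits (I.n + 2) v j = I.n + 2 - 1 := by
    intro j hj
    have h1 := Nat.find_min hex hj
    have h2 : baseDigits (I.n + 2) v j < I.n + 2 := Nat.mod_lt _ (by omega)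
    omega
  have hcv : baseDigits (I.n + 2) v c < I.n + 1 := Nat.find_spec hex
  have hsucc := baseDigits_succ (c := c) (by omega) hlow (by simpa using hcv)
  refine Runs.mono (T := 3 + ((c * (6 + 12 + 1) + (6 + 1)) + 20)) ?_ (by omega) fun _ h => h
  refine Runs.seq (R := fun u => u = s.writeNat 3 0 0) (runs_setNat (by decide) rfl) ?_
  rintro u rfl
  refine Runs.seq (runs_loop (B := 12) c (fun i u => u.nat 0 0 = I.n ∧ u.nat 3 0 = i ∧
    u.nat 1 = fun j => if j < i then 0 else baseDigits (I.n + 2) v j) ?_ ?_ ?_) ?_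
  · rintro i hi u ⟨h1, h2, h3⟩
    constructor
    · simp [Test.Holds, NExp.eval, h1, h2, h3, hlow i hi]
    · refine ⟨_, _, .seq (.setNat _ _ _ _) (.setNat _ _ _ _), by decide, ?_⟩
      simp only [NExp.eval, h2]
      refine ⟨by simpa using h1, by simp [h2], ?_⟩
      funext j
      simp only [ne_eq, OfNat.one_ne_ofNat, not_false_eq_true, Store.nat_writeNat_ne,
        Store.nat_writeNat_same, h3, Function.update_apply]
      split_ifs <;> first | rfl | omega
  · rintro u ⟨h1, h2, h3⟩
    simp [Test.Holds, NExp.eval, h1, h2, h3]; omega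
  · exact ⟨by simpa using hs.n, by simp, by simpa using hD⟩
  · rintro u ⟨h1, h2, h3⟩
    refine runs_setNat (by decide) ?_
    simp only [NExp.eval, h2, Store.nat_writeNat_same, h3]
    rw [hsucc]
    funext j
    simp only [Function.update_apply]
    split_ifs <;> first | rfl | omega

/-- The time for one sequence of digits. -/
def passTime (I : ScalingInstance) (f : Polynomial ℕ) : ℕ :=
  3000 * (I.n + 2) ^ 2 * (I.k + 1) ^ 2 + 12 * f.eval (1 + I.n ^ 2)

/-- The invariant of the main loop: the next sequence of digits is the `v`th one. -/
structure MainInv (I : ScalingInstance) (C : GraphClass) (v : ℕ) (s : Store) : Prop where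
  input : HasInput I s
  digits : s.nat 1 = baseDigits (I.n + 2) v
  base : s.nat 10 0 = s.nat 11 0
  zero : s.ZeroFrom (s.nat 11 0)
  found : s.nat 8 0 ≠ 0 ↔ ∃ v' < v, I.Valid C (baseDigits (I.n + 2) v')

lemma runs_pass {C : GraphClass} {p : Prog} {f : Polynomial ℕ}
    (hp : Solves p C.recognition fun x => f.eval (C.recognition.size x)) {v : ℕ}
    (hv : v < (I.n + 2) ^ (I.k + I.k + I.k)) (h : MainInv I C v s) :
    Runs (.seq initProg (.seq roundsProg (.seq checkProg (.seq graphProg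
        (.seq p.reloc (.seq collectProg nextProg)))))) s (passTime I f)
      (MainInv I C (v + 1)) := by
  set D := baseDigits (I.n + 2) v with hDdef
  have hD : ∀ j, D j < I.n + 2 := fun j => Nat.mod_lt _ (by omega)
  have hs : Context I D (s.nat 8) (s.nat 11 0) s := ⟨h.input, h.digits, rfl, h.base, rfl, h.zero⟩
  have hfound := h.found
  set F := s.nat 8 with hF
  refine Runs.mono (T := 100 * (I.n + 2) + (1200 * (I.k + 1) ^ 2 + (300 * (I.k + 1) +
    (600 * (I.n + 1) ^ 2 + (12 * f.eval (1 + I.n ^ 2) + (30 + 200 * (I.k + 1))))))) ?_ ?_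
    fun _ h => h
  · refine (runs_init hs).seq ?_
    rintro s₁ ⟨hs₁, hV₁⟩
    refine (runs_rounds hs₁ hD hV₁).seq ?_
    rintro s₂ ⟨hs₂, hV₂⟩
    refine (runs_check hs₂ hD hV₂).seq ?_
    rintro s₃ ⟨hs₃, hV₃, hok⟩
    refine (runs_graph hs₃ hV₃).frame.seq ?_
    rintro s₄ ⟨hrel, hn₄, hr₄⟩
    -- The run of `p` on a clean memory holding the candidate graph is transferred to the relocated
    -- block.
    obtain ⟨t, r, hexec, ht, hans⟩ := hp ⟨I.n, I.lexGraph (I.candidate D)⟩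
    refine ((hexec.reloc hrel).frame.mono (Nat.mul_le_mul_left 12 ht) fun _ h => h).seq ?_
    rintro s₅ ⟨hrel₅, hn₅, hr₅⟩
    have hnat : ∀ a < 10, a ≠ 3 → a ≠ 4 → a ≠ 7 → s₅.nat a = s₃.nat a := by
      intro a h1 h2 h3 h4
      rw [hn₅ a (p.keepsNat_reloc (by omega)), hn₄ a]
      simp [graphProg, adjacencyProg, forLoop, Prog.KeepsNat]
      omega
    have hreal : ∀ a < 10, s₅.real a = s₃.real a := by
      intro a h1
      rw [hr₅ a (p.keepsReal_reloc (by omega)), hr₄ a]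
      simp [graphProg, adjacencyProg, forLoop, Prog.KeepsReal]
    have hinput : HasInput I s₅ := ⟨(hnat 0 (by omega) (by omega) (by omega) (by omega)).trans
      hs₃.input.nat, (hreal 0 (by omega)).trans hs₃.input.real0,
      (hreal 1 (by omega)).trans hs₃.input.real1, (hreal 2 (by omega)).trans hs₃.input.real2⟩
    have h1 : s₅.nat 1 = D := (hnat 1 (by omega) (by omega) (by omega) (by omega)).trans hs₃.digits
    have h8 : s₅.nat 8 = F := (hnat 8 (by omega) (by omega) (by omega) (by omega)).trans hs₃.found
    have h9 : s₅.nat 9 = s₃.nat 9 := hnat 9 (by omega) (by omega) (by omega) (by omega)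
    have hres : s₅.nat 12 (s₅.nat 10 0) = r.nat 0 0 := by simpa using hrel₅.nat 0 0
    have hval : 0 < s₅.nat 9 0 ∧ 0 < s₅.nat 12 (s₅.nat 10 0) ↔ I.Valid C D := by
      rw [hres, h9, Nat.pos_iff_ne_zero, Nat.pos_iff_ne_zero, hok, hans]; rfl
    refine Runs.seq (R := fun u => u.nat 1 = D ∧ HasInput I u ∧ u.nat 10 0 = u.nat 11 0 ∧
      u.ZeroFrom (u.nat 11 0) ∧
      (u.nat 8 0 ≠ 0 ↔ ∃ v' < v + 1, I.Valid C (baseDigits (I.n + 2) v'))) ?_ ?_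
    · refine Runs.mono (T := 20 + 5) ?_ (by decide) fun _ h => h
      refine Runs.seq (R := fun u => u.nat 1 = D ∧ HasInput I u ∧ u.ZeroFrom (u.nat 11 0) ∧
        (u.nat 8 0 ≠ 0 ↔ ∃ v' < v + 1, I.Valid C (baseDigits (I.n + 2) v'))) ?_ ?_
      · have hsucc : (∃ v' < v + 1, I.Valid C (baseDigits (I.n + 2) v')) ↔
            (∃ v' < v, I.Valid C (baseDigits (I.n + 2) v')) ∨ I.Valid C D :=
          Nat.exists_lt_succ_right
        refine (runs_ite (T := 5) (fun hb => ?_) fun hb => ?_).mono (by decide) fun _ h => h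
        · refine runs_setNat (by decide) ⟨by simpa using h1, ⟨by simpa using hinput.nat,
            hinput.real0, hinput.real1, hinput.real2⟩, fun a i hi => ?_, ?_⟩
          · simpa using hrel₅.zero a i (by simpa using hi)
          · rw [hsucc, ← hval]
            simp only [NExp.eval, Store.nat_writeNat_same, Function.update_self]
            exact iff_of_true one_ne_zero (.inr (by simpa [Test.Holds, NExp.eval] using hb))
        · refine runs_skip (by decide) ⟨h1, hinput, hrel₅.zero, ?_⟩
          rw [hsucc, ← hval, h8, hfound, or_iff_left]
          simpa [Test.Holds, NExp.eval] using hb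
      · rintro u ⟨i1, i2, i3, i4⟩
        refine runs_setNat (by decide) ⟨by simpa using i1, ⟨by simpa using i2.nat, i2.real0,
          i2.real1, i2.real2⟩, by simp [NExp.eval], fun a i hi => ?_, by simpa using i4⟩
        simpa using i3 a i (by simpa using hi)
    · rintro u ⟨i1, i2, i3, i4, i5⟩
      refine (runs_next i2 i1 hv).frame.mono le_rfl ?_
      rintro u' ⟨j1, j2, j3⟩
      have hn : ∀ a, a ≠ 1 → a ≠ 3 → u'.nat a = u.nat a := fun a h1 h2 =>
        j2 a (by simp [nextProg, Prog.KeepsNat, h1, h2])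
      have hr : ∀ a, u'.real a = u.real a := fun a =>
        j3 a (by simp [nextProg, Prog.KeepsReal])
      refine ⟨⟨by rw [hn 0 (by omega) (by omega), i2.nat], by rw [hr, i2.real0],
        by rw [hr, i2.real1], by rw [hr, i2.real2]⟩, j1, ?_, fun a i hi => ?_, ?_⟩
      · rw [hn 10 (by omega) (by omega), hn 11 (by omega) (by omega), i3]
      · rw [hn 11 (by omega) (by omega)] at hi
        rw [hn (a + 12) (by omega) (by omega), hr]
        exact i4 a i hi
      · rw [hn 8 (by omega) (by omega), i5]
  · unfold passTime
    have a1 : 1 ≤ (I.n + 2) ^ 2 := Nat.one_le_pow _ _ (by omega)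
    have a2 : 1 ≤ (I.k + 1) ^ 2 := Nat.one_le_pow _ _ (by omega)
    have a3 : I.n + 2 ≤ (I.n + 2) ^ 2 := Nat.le_self_pow (by decide) _
    have a4 : I.k + 1 ≤ (I.k + 1) ^ 2 := Nat.le_self_pow (by decide) _
    have a5 : (I.n + 1) ^ 2 ≤ (I.n + 2) ^ 2 := Nat.pow_le_pow_left (by omega) 2
    have a6 := Nat.mul_le_mul_left ((I.n + 2) ^ 2) a2
    have a7 := Nat.mul_le_mul_right ((I.k + 1) ^ 2) a1
    rw [mul_assoc]
    omega

/-- The main program solves the scaling problem. -/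
theorem solves_mainProg {C : GraphClass} {p : Prog} {f : Polynomial ℕ}
    (hp : Solves p C.recognition fun x => f.eval (C.recognition.size x)) :
    Solves (mainProg p) C.scaling fun I : ScalingInstance =>
      100 * ((I.n + 2) ^ (I.k + I.k + I.k) * passTime I f) := by
  intro (I : ScalingInstance)
  set N := (I.n + 2) ^ (I.k + I.k + I.k) with hN
  have hNpos : 1 ≤ N := Nat.one_le_pow _ _ (by omega)
  have hpass : 1 ≤ passTime I f := by
    have : 0 < 3000 * (I.n + 2) ^ 2 * (I.k + 1) ^ 2 := by positivity
    unfold passTime; omega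
  have hdigit : ∀ v s, MainInv I C v s →
      (NExp.read 1 (.add (.add kE kE) kE)).eval s = v / N % (I.n + 2) := by
    intro v s h
    simp only [NExp.eval, h.input.k, h.digits]; rfl
  have key : Runs (mainProg p) (scalingStore I)
      ((N * (11 + passTime I f + 1) + (11 + 1)) + 4) (fun s => s.nat 0 0 ≠ 0 ↔ C.scaling.Yes I) := by
    refine Runs.seq (runs_loop N (MainInv I C) ?_ ?_ ?_) ?_
    · intro v hv s h
      refine ⟨?_, runs_pass hp hv h⟩
      rw [Test.Holds, hdigit v s h, Nat.div_eq_of_lt hv]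
      simp [NExp.eval]
    -- Digit `3k` of `N = (n + 2) ^ (3k)` is `1`: this overflow digit, zero for all smaller values,
    -- ends the loop.
    · intro s h
      rw [Test.Holds, hdigit N s h, Nat.div_self hNpos, Nat.mod_eq_of_lt (by omega)]
      simp [NExp.eval]
    · refine ⟨⟨rfl, rfl, rfl, rfl⟩, ?_, rfl, fun a i _ => ⟨rfl, rfl⟩, ?_⟩
      · funext j
        simp [scalingStore, baseDigits]
      · simp [scalingStore]
    · intro s h
      refine runs_setNat (by decide) ?_
      rw [I.yes_iff, ← h.found]
      simp [NExp.eval]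
  obtain ⟨t, s, h1, h2, h3⟩ := key
  refine ⟨t, s, h1, h2.trans ?_, h3⟩
  have := Nat.mul_le_mul hNpos hpass
  have h4 : N ≤ N * passTime I f := Nat.le_mul_of_pos_right _ hpass
  change _ ≤ 100 * (N * passTime I f)
  calc _ = N * passTime I f + 12 * N + 16 := by ring
    _ ≤ _ := by omega

end Scaling

end RealRAM

/-! ### Estimates of the running time -/

/-- A polynomial with natural coefficients grows at most like a power. -/
lemma Polynomial.eval_le_mul_pow (f : Polynomial ℕ) {x : ℕ} (hx : 1 ≤ x) :
    f.eval x ≤ f.eval 1 * x ^ f.natDegree := by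
  rw [Polynomial.eval_eq_sum_range, Polynomial.eval_eq_sum_range, Finset.sum_mul]
  refine Finset.sum_le_sum fun i hi => ?_
  rw [one_pow, mul_one]
  exact Nat.mul_le_mul_left _ (Nat.pow_le_pow_right hx (Finset.mem_range_succ_iff.1 hi))

namespace RealRAM.Scaling

lemma passTime_le (f : Polynomial ℕ) : ∃ a b : ℕ, ∀ I : ScalingInstance,
    passTime I f ≤ 2 ^ (a * max I.k 1) * max I.n 1 ^ b := by
  set A := f.eval 1 with hA
  set d := f.natDegree with hd
  refine ⟨3000 * 9 * 4 + 12 * A + d + 2, 2 + 2 * d, fun I => ?_⟩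
  set n := max I.n 1 with hn
  set k := max I.k 1 with hk
  have hn1 : 1 ≤ n := le_max_right _ _
  have hk1 : 1 ≤ k := le_max_right _ _
  have hnI : I.n ≤ n := le_max_left _ _
  have hkI : I.k ≤ k := le_max_left _ _
  have h1 : (I.n + 2) ^ 2 ≤ 9 * n ^ 2 := by
    calc (I.n + 2) ^ 2 ≤ (3 * n) ^ 2 := Nat.pow_le_pow_left (by omega) 2
      _ = 9 * n ^ 2 := by ring
  -- Polynomial factors in `k`, and constants further below, are absorbed into a power of two by `m
  -- ≤ 2 ^ m`.
  have h2 : (I.k + 1) ^ 2 ≤ 4 * 2 ^ (2 * k) := by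
    calc (I.k + 1) ^ 2 ≤ (2 * k) ^ 2 := Nat.pow_le_pow_left (by omega) 2
      _ = 4 * k ^ 2 := by ring
      _ ≤ 4 * (2 ^ k) ^ 2 := Nat.mul_le_mul_left _ (Nat.pow_le_pow_left Nat.lt_two_pow_self.le 2)
      _ = 4 * 2 ^ (2 * k) := by rw [← pow_mul, mul_comm k 2]
  have h3 : f.eval (1 + I.n ^ 2) ≤ A * (2 ^ d * n ^ (2 * d)) := by
    refine (f.eval_le_mul_pow (by omega)).trans (Nat.mul_le_mul_left _ ?_)
    calc (1 + I.n ^ 2) ^ d ≤ (2 * n ^ 2) ^ d := by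
          refine Nat.pow_le_pow_left ?_ d
          have := Nat.pow_le_pow_left hnI 2
          have := Nat.one_le_pow 2 n hn1
          omega
      _ = 2 ^ d * n ^ (2 * d) := by rw [mul_pow, ← pow_mul]
  calc passTime I f ≤ 3000 * (9 * n ^ 2) * (4 * 2 ^ (2 * k)) + 12 * (A * (2 ^ d * n ^ (2 * d))) := by
        unfold passTime; gcongr
    _ ≤ 3000 * (9 * n ^ (2 + 2 * d)) * (4 * (2 ^ (2 * k) * 2 ^ d)) +
        12 * (A * (2 ^ d * 2 ^ (2 * k) * n ^ (2 + 2 * d))) := by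
        have h4 : n ^ 2 ≤ n ^ (2 + 2 * d) := Nat.pow_le_pow_right hn1 (by omega)
        have h5 : n ^ (2 * d) ≤ n ^ (2 + 2 * d) := Nat.pow_le_pow_right hn1 (by omega)
        have h6 : 2 ^ (2 * k) ≤ 2 ^ (2 * k) * 2 ^ d := Nat.le_mul_of_pos_right _ (by positivity)
        have h7 : 2 ^ d ≤ 2 ^ d * 2 ^ (2 * k) := Nat.le_mul_of_pos_right _ (by positivity)
        exact Nat.add_le_add (Nat.mul_le_mul (Nat.mul_le_mul_left _ (Nat.mul_le_mul_left _ h4))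
          (Nat.mul_le_mul_left _ h6)) (Nat.mul_le_mul_left _ (Nat.mul_le_mul_left _
            (Nat.mul_le_mul h7 h5)))
    _ = (3000 * 9 * 4 + 12 * A) * (2 ^ d * 2 ^ (2 * k)) * n ^ (2 + 2 * d) := by ring
    _ ≤ 2 ^ (3000 * 9 * 4 + 12 * A) * (2 ^ d * 2 ^ (2 * k)) * n ^ (2 + 2 * d) := by
        gcongr
        exact Nat.lt_two_pow_self.le
    _ = 2 ^ (3000 * 9 * 4 + 12 * A + (d + 2 * k)) * n ^ (2 + 2 * d) := by
        rw [pow_add 2 _ (d + 2 * k), pow_add 2 d]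
    _ ≤ _ := by
        gcongr
        · norm_num
        · nlinarith [Nat.mul_le_mul_left (3000 * 9 * 4 + 12 * A + d) hk1]

lemma totalTime_le (f : Polynomial ℕ) : ∃ c : ℕ, ∀ I : ScalingInstance,
    100 * ((I.n + 2) ^ (I.k + I.k + I.k) * passTime I f) ≤
      2 ^ (c * max I.k 1 ^ 2) * max I.n 1 ^ (c * max I.k 1) := by
  obtain ⟨a, b, hab⟩ := passTime_le f
  -- The terms come from `100 ≤ 2 ^ 7`, from `(n + 2) ^ (3k) ≤ 2 ^ (6k) * n ^ (3k)`, and from the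
  -- bound on `passTime`.
  refine ⟨7 + 6 + a + (3 + b), fun I => ?_⟩
  have hpass := hab I
  set n := max I.n 1 with hn
  set k := max I.k 1 with hk
  have hn1 : 1 ≤ n := le_max_right _ _
  have hk1 : 1 ≤ k := le_max_right _ _
  have hnI : I.n ≤ n := le_max_left _ _
  have hkI : I.k ≤ k := le_max_left _ _
  have h1 : (I.n + 2) ^ (I.k + I.k + I.k) ≤ 2 ^ (6 * k) * n ^ (3 * k) := by
    calc (I.n + 2) ^ (I.k + I.k + I.k) ≤ (2 ^ 2 * n) ^ (I.k + I.k + I.k) :=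
          Nat.pow_le_pow_left (by omega) _
      _ ≤ (2 ^ 2 * n) ^ (3 * k) := Nat.pow_le_pow_right (by omega) (by omega)
      _ = 2 ^ (6 * k) * n ^ (3 * k) := by rw [mul_pow, ← pow_mul]; ring_nf
  calc 100 * ((I.n + 2) ^ (I.k + I.k + I.k) * passTime I f)
      ≤ 2 ^ 7 * (2 ^ (6 * k) * n ^ (3 * k) * (2 ^ (a * k) * n ^ b)) := by
        gcongr
        norm_num
    _ = 2 ^ (7 + 6 * k + a * k) * n ^ (3 * k + b) := by rw [pow_add, pow_add, pow_add]; ring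
    _ ≤ _ := by
        have hk2 : k ≤ k ^ 2 := Nat.le_self_pow (by decide) k
        refine Nat.mul_le_mul (Nat.pow_le_pow_right two_pos ?_) (Nat.pow_le_pow_right hn1 ?_)
        · nlinarith [Nat.mul_le_mul_left a hk2, Nat.mul_le_mul_left b (hk1.trans hk2)]
        · nlinarith [Nat.mul_le_mul_left b hk1, Nat.zero_le (a * k)]

end RealRAM.Scaling

/-! ### Computability of the bounds and the main theorem -/

lemma computable_two_pow_mul_sq (c : ℕ) : Computable fun k : ℕ => 2 ^ (c * max k 1 ^ 2) := by
  have hmul : Primrec₂ ((· * ·) : ℕ → ℕ → ℕ) := Primrec.nat_mul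
  have hmax : Primrec fun k : ℕ => max k 1 := Primrec.nat_max.comp .id (.const 1)
  have hexp : Primrec fun k : ℕ => c * max k 1 ^ 2 := by
    simpa only [sq] using hmul.comp (.const c) (hmul.comp hmax hmax)
  have hpow : Primrec fun m : ℕ => 2 ^ m := by
    refine (Primrec.nat_rec₁ 1 (f := fun _ r => r * 2)
      (hmul.comp .snd (.const 2))).of_eq fun m => ?_
    induction m with
    | zero => rfl
    | succ m ih => rw [pow_succ, ← ih]
  exact (hpow.comp hexp).to_comp

lemma computable_mul_max (c : ℕ) : Computable fun k : ℕ => c * max k 1 :=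
  (Primrec.nat_mul.comp (.const c) (Primrec.nat_max.comp .id (.const 1))).to_comp

/-- If the recognition problem of a graph class can be solved in polynomial time, then the scaling
problem of that class can be solved in time `2 ^ O(k ^ 2) * n ^ O(k)` (where `n` and `k` are read
as `1` if they are `0`), and hence it is in XP with respect to `k`. -/
theorem theorem3p3 (C : GraphClass) (hC : C.recognition.InPolyTime) :
    (∃ (p : RealRAM.Prog) (c : ℕ), RealRAM.Solves p C.scaling
      (fun I : ScalingInstance => 2 ^ (c * max I.k 1 ^ 2) * max I.n 1 ^ (c * max I.k 1))) ∧
    C.scaling.InXP (fun I : ScalingInstance => I.k) := by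
  obtain ⟨p, f, hp⟩ := hC
  obtain ⟨c, hc⟩ := RealRAM.Scaling.totalTime_le f
  have hsolve : RealRAM.Solves (RealRAM.Scaling.mainProg p) C.scaling
      (fun I : ScalingInstance => 2 ^ (c * max I.k 1 ^ 2) * max I.n 1 ^ (c * max I.k 1)) := by
    intro I
    obtain ⟨t, s, h1, h2, h3⟩ := RealRAM.Scaling.solves_mainProg hp I
    exact ⟨t, s, h1, h2.trans (hc I), h3⟩
  refine ⟨⟨_, c, hsolve⟩, RealRAM.Scaling.mainProg p, _, _, computable_two_pow_mul_sq c, computable_mul_max c, ?_⟩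
  intro (I : ScalingInstance)
  obtain ⟨t, s, h1, h2, h3⟩ := hsolve I
  refine ⟨t, s, h1, h2.trans (Nat.mul_le_mul_left _ (Nat.pow_le_pow_left ?_ _)), h3⟩
  change max I.n 1 ≤ 4 + 2 * I.n
  omega
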